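/- Let $1<p<\infty$. There is a constant $c_p>0$, depending only on $p$, with the following property. Let $n\ge 1$ and let $\Omega\subset\mathbb R^n$ be a smooth bounded domain, with exterior unit normal derivative $\partial_\nu$ and surface measure $d\nu$ on $\partial\Omega$. For $k\in\{1,\infty\}$ let $C^k(\overline\Omega)$ denote the set of restrictions to $\overline\Omega$ of real-valued $C^k$ functions on $\mathbb R^n$. Let $a\in C^1(\overline\Omega)$ be nonnegative, let $u\in C^\infty(\overline\Omega)$ be positive on $\overline\Omega$, and let $b\in L^1_{\rm loc}(\Omega)$ and $\beta\in L^1_{\rm loc}(\partial\Omega)$ be such that $$-\nabla\cdot\big(a|\nabla u|^{p-2}\nabla u\big)\ \ge\ b\,u^{p-1}\quad\text{a.e. in }\Omega,\qquad a|\nabla u|^{p-2}\,\partial_\nu u=\beta\,u^{p-1}\quad\text{a.e. on }\partial\Omega ,$$ where $|\nabla u|^{p-2}\nabla u:=0$ at points where $\nabla u=0$, and the first condition means that the field $a|\nabla u|^{p-2}\nabla u$ is differentiable and satisfies the inequality at almost every point of $\Omega$. Then for every $\phi\in C^\infty(\overline\Omega)$: if $p\ge2$, $$\int_\Omega a|\nabla\phi|^p\,dx\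 \ge\ \int_\Omega b|\phi|^p\,dx+c_p\int_\Omega a\,\Big|\nabla\Big(\frac{\phi}{u}\Big)\Big|^p u^p\,dx+\int_{\partial\Omega}\beta|\phi|^p\,d\nu ,$$ and if $1<p<2$, $$\int_\Omega a|\nabla\phi|^p\,dx\ \ge\ \int_\Omega b|\phi|^p\,dx+c_p\int_\Omega a\,\frac{|\nabla(\phi/u)|^2u^2}{\big(|\frac{\phi}{u}\nabla u|+|\nabla(\phi/u)|\,u\big)^{2-p}}\,dx+\int_{\partial\Omega}\beta|\phi|^p\,d\nu ,$$ where the last quotient is read as $0$ where its denominator vanishes. All these integrals converge absolutely, except that $\int_\Omega b|\phi|^p\,dx$, whose positive part is finite, may equal $-\infty$, in which case the inequality holds trivially. -/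

import Mathlib

open MeasureTheory Set Filter Topology
open scoped ContDiff

noncomputable section

/-- Near the point `x`, the set `Ω` lies below the graph, in the direction of the unit vector `e`,
of the smooth function `γ` of the variables orthogonal to `e` (that is, `γ` is constant along `e`).
In an orthonormal coordinate system whose last axis points along `e`, this says that
`Ω` agrees near `x` with `{y | yₙ < γ (y₁, …, yₙ₋₁)}`. -/
def IsBoundaryGraphAt {n : ℕ} (Ω : Set (EuclideanSpace ℝ (Fin n)))
    (x e : EuclideanSpace ℝ (Fin n)) (γ : EuclideanSpace ℝ (Fin n) → ℝ) : Prop :=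
  ‖e‖ = 1 ∧ ContDiff ℝ ∞ γ ∧ (∀ (y : EuclideanSpace ℝ (Fin n)) (t : ℝ), γ (y + t • e) = γ y) ∧
    ∀ᶠ y in 𝓝 x, (y ∈ Ω ↔ inner ℝ y e < γ y)

/-- A smooth bounded domain in `ℝⁿ`: a non-empty connected bounded open set which, near every
point of its boundary, is the region on one side of the graph of a smooth function. -/
structure IsSmoothBoundedDomain {n : ℕ} (Ω : Set (EuclideanSpace ℝ (Fin n))) : Prop where
  isOpen : IsOpen Ω
  isConnected : IsConnected Ω
  isBounded : Bornology.IsBounded Ω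
  smooth_boundary : ∀ x ∈ frontier Ω, ∃ e γ, IsBoundaryGraphAt Ω x e γ

/-- `ν` is the exterior unit normal of `Ω` at the boundary point `x`: the normalized gradient of
the function `y ↦ ⟪y, e⟫ - γ y` which is negative in `Ω` and non-negative outside `Ω` near `x`. -/
def IsExteriorUnitNormalAt {n : ℕ} (Ω : Set (EuclideanSpace ℝ (Fin n)))
    (x ν : EuclideanSpace ℝ (Fin n)) : Prop :=
  ∃ e γ, IsBoundaryGraphAt Ω x e γ ∧ ν = ‖e - gradient γ x‖⁻¹ • (e - gradient γ x)

/-- A vector pointing strictly inwards for one graph representation does not point strictly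
outwards for another one. -/
theorem IsBoundaryGraphAt.inner_nonpos {n : ℕ} {Ω : Set (EuclideanSpace ℝ (Fin n))}
    {x e₁ e₂ : EuclideanSpace ℝ (Fin n)} {γ₁ γ₂ : EuclideanSpace ℝ (Fin n) → ℝ}
    (hx : x ∈ frontier Ω) (hΩ : IsOpen Ω)
    (h₁ : IsBoundaryGraphAt Ω x e₁ γ₁) (h₂ : IsBoundaryGraphAt Ω x e₂ γ₂)
    (v : EuclideanSpace ℝ (Fin n)) (hv : inner ℝ (e₁ - gradient γ₁ x) v < 0) :
    inner ℝ (e₂ - gradient γ₂ x) v ≤ 0 := by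
  have hd : ∀ {e : EuclideanSpace ℝ (Fin n)} {γ : EuclideanSpace ℝ (Fin n) → ℝ},
      IsBoundaryGraphAt Ω x e γ → HasDerivAt
        (fun t : ℝ => inner ℝ (x + t • v) e - γ (x + t • v)) (inner ℝ (e - gradient γ x) v) 0 := by
    intro e γ h
    have hl : HasDerivAt (fun t : ℝ => x + t • v) v 0 := by
      simpa using ((hasDerivAt_id (0 : ℝ)).smul_const v).const_add x
    have hγ : HasFDerivAt γ (fderiv ℝ γ x) (x + (0 : ℝ) • v) := by
      simpa using (h.2.1.differentiable (by simp) x).hasFDerivAt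
    have h1 := (hl.inner ℝ (hasDerivAt_const (0 : ℝ) e)).sub (hγ.comp_hasDerivAt (0 : ℝ) hl)
    have h2 : inner ℝ (e - gradient γ x) v =
        inner ℝ (x + (0 : ℝ) • v) 0 + inner ℝ v e - (fderiv ℝ γ x) v := by
      rw [inner_sub_left, gradient, InnerProductSpace.toDual_symm_apply, inner_zero_right,
        zero_add, real_inner_comm]
    rw [h2]
    exact h1
  have h0 : ∀ {e : EuclideanSpace ℝ (Fin n)} {γ : EuclideanSpace ℝ (Fin n) → ℝ},
      IsBoundaryGraphAt Ω x e γ → inner ℝ x e - γ x = 0 := by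
    intro e γ h
    have hc : Continuous fun y => inner ℝ y e - γ y :=
      (continuous_id.inner continuous_const).sub h.2.1.continuous
    have hxΩ : x ∉ Ω := by
      rw [hΩ.frontier_eq] at hx
      exact hx.2
    have hle : inner ℝ x e - γ x ≤ 0 := by
      by_contra hlt
      push Not at hlt
      have := (hc.continuousAt (x := x)).eventually (lt_mem_nhds hlt)
      have hcl := mem_closure_iff_frequently.1 (frontier_subset_closure hx)
      obtain ⟨y, hy, hy1, hy2⟩ := (hcl.and_eventually (this.and h.2.2.2)).exists
      have := hy2.1 hy
      linarith
    have hge : ¬ inner ℝ x e < γ x := fun hlt => hxΩ (h.2.2.2.self_of_nhds.2 hlt)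
    linarith
  have hl : Tendsto (fun t : ℝ => x + t • v) (𝓝[>] 0) (𝓝 x) := by
    have : Continuous fun t : ℝ => x + t • v := by fun_prop
    simpa using (this.tendsto 0).mono_left nhdsWithin_le_nhds
  have hs₁ := (hasDerivAt_iff_tendsto_slope_zero.1 (hd h₁)).mono_left
    (nhdsGT_le_nhdsNE (0 : ℝ))
  have hs₂ := (hasDerivAt_iff_tendsto_slope_zero.1 (hd h₂)).mono_left
    (nhdsGT_le_nhdsNE (0 : ℝ))
  refine le_of_tendsto hs₂ ?_
  filter_upwards [hs₁.eventually (gt_mem_nhds hv), hl.eventually h₁.2.2.2,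
    hl.eventually h₂.2.2.2, self_mem_nhdsWithin] with t ht hm₁ hm₂ htpos
  have htpos : 0 < t := htpos
  simp only [zero_add, zero_smul, add_zero, h0 h₁, h0 h₂, sub_zero, smul_eq_mul] at ht ⊢
  have hneg : inner ℝ (x + t • v) e₁ - γ₁ (x + t • v) < 0 := by
    by_contra hcon
    push Not at hcon
    have := mul_nonneg (inv_nonneg.2 htpos.le) hcon
    linarith
  have := hm₂.1 (hm₁.2 (by linarith))
  exact mul_nonpos_of_nonneg_of_nonpos (inv_nonneg.2 htpos.le) (by linarith)

/-- The vector whose normalization is the exterior normal does not vanish. -/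
theorem IsBoundaryGraphAt.ne_zero {n : ℕ} {Ω : Set (EuclideanSpace ℝ (Fin n))}
    {x e : EuclideanSpace ℝ (Fin n)} {γ : EuclideanSpace ℝ (Fin n) → ℝ}
    (h : IsBoundaryGraphAt Ω x e γ) : e - gradient γ x ≠ 0 := by
  intro h0
  have hγ : HasFDerivAt γ (fderiv ℝ γ x) (x + (0 : ℝ) • e) := by
    simpa using (h.2.1.differentiable (by simp) x).hasFDerivAt
  have hl : HasDerivAt (fun t : ℝ => x + t • e) e 0 := by
    simpa using ((hasDerivAt_id (0 : ℝ)).smul_const e).const_add x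
  have h1 := hγ.comp_hasDerivAt (0 : ℝ) hl
  have h2 : HasDerivAt (γ ∘ fun t : ℝ => x + t • e) 0 0 := by
    have : (γ ∘ fun t : ℝ => x + t • e) = fun _ => γ x := funext fun t => h.2.2.1 x t
    rw [this]
    exact hasDerivAt_const _ _
  have h3 : inner ℝ (gradient γ x) e = 0 := by
    rw [gradient, InnerProductSpace.toDual_symm_apply]
    exact h1.unique h2
  rw [← sub_eq_zero.1 h0, real_inner_self_eq_norm_sq, h.1] at h3
  norm_num at h3

/-- The exterior unit normal does not depend on the representation of the boundary. -/
theorem IsExteriorUnitNormalAt.unique {n : ℕ} {Ω : Set (EuclideanSpace ℝ (Fin n))}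
    {x ν₁ ν₂ : EuclideanSpace ℝ (Fin n)} (hx : x ∈ frontier Ω) (hΩ : IsOpen Ω)
    (h₁ : IsExteriorUnitNormalAt Ω x ν₁) (h₂ : IsExteriorUnitNormalAt Ω x ν₂) : ν₁ = ν₂ := by
  obtain ⟨e₁, γ₁, hg₁, rfl⟩ := h₁
  obtain ⟨e₂, γ₂, hg₂, rfl⟩ := h₂
  have key := hg₁.inner_nonpos hx hΩ hg₂
  have hp₁ := norm_pos_iff.2 hg₁.ne_zero
  have hp₂ := norm_pos_iff.2 hg₂.ne_zero
  generalize e₁ - gradient γ₁ x = g₁ at *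
  generalize e₂ - gradient γ₂ x = g₂ at *
  have hu₁ : ‖‖g₁‖⁻¹ • g₁‖ = 1 := by
    rw [norm_smul, norm_inv, norm_norm, inv_mul_cancel₀ hp₁.ne']
  have hu₂ : ‖‖g₂‖⁻¹ • g₂‖ = 1 := by
    rw [norm_smul, norm_inv, norm_norm, inv_mul_cancel₀ hp₂.ne']
  have e1 : g₁ = ‖g₁‖ • (‖g₁‖⁻¹ • g₁) := by rw [smul_inv_smul₀ hp₁.ne']
  have e2 : g₂ = ‖g₂‖ • (‖g₂‖⁻¹ • g₂) := by rw [smul_inv_smul₀ hp₂.ne']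
  generalize hn₁ : ‖g₁‖⁻¹ • g₁ = n₁ at *
  generalize hn₂ : ‖g₂‖⁻¹ • g₂ = n₂ at *
  by_contra hne
  have hlt : inner ℝ n₁ n₂ < 1 := (inner_lt_one_iff_real_of_norm_eq_one hu₁ hu₂).2 hne
  have i1 : inner ℝ g₁ (n₂ - n₁) = ‖g₁‖ * (inner ℝ n₁ n₂ - 1) := by
    conv_lhs => rw [e1]
    rw [real_inner_smul_left, inner_sub_right, real_inner_self_eq_norm_sq, hu₁]
    norm_num
  have i2 : inner ℝ g₂ (n₂ - n₁) = ‖g₂‖ * (1 - inner ℝ n₁ n₂) := by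
    conv_lhs => rw [e2]
    rw [real_inner_smul_left, inner_sub_right, real_inner_self_eq_norm_sq, hu₂,
      real_inner_comm n₁ n₂]
    norm_num
  have := key (n₂ - n₁) (by rw [i1]; exact mul_neg_of_pos_of_neg hp₁ (by linarith))
  rw [i2] at this
  have := mul_pos hp₂ (show 0 < 1 - inner ℝ n₁ n₂ by linarith)
  linarith

open Classical in
/-- The exterior unit normal of `Ω` at `x` (zero where there is none). -/
def exteriorUnitNormal {n : ℕ} (Ω : Set (EuclideanSpace ℝ (Fin n)))
    (x : EuclideanSpace ℝ (Fin n)) : EuclideanSpace ℝ (Fin n) :=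
  if h : ∃ ν, IsExteriorUnitNormalAt Ω x ν then h.choose else 0

/-- The exterior normal derivative of `u` at `x`. -/
def exteriorNormalDeriv {n : ℕ} (Ω : Set (EuclideanSpace ℝ (Fin n)))
    (u : EuclideanSpace ℝ (Fin n) → ℝ) (x : EuclideanSpace ℝ (Fin n)) : ℝ :=
  fderiv ℝ u x (exteriorUnitNormal Ω x)

/-- The surface measure on the boundary of `Ω`: the `(n-1)`-dimensional Hausdorff measure
(normalized so as to agree with Lebesgue measure on `ℝⁿ⁻¹`) restricted to the boundary. -/
def surfaceMeasure {n : ℕ} (Ω : Set (EuclideanSpace ℝ (Fin n))) :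
    Measure (EuclideanSpace ℝ (Fin n)) :=
  (Measure.euclideanHausdorffMeasure (n - 1)).restrict (frontier Ω)

/-- The divergence of a vector field, `∑ᵢ ∂ᵢ Fᵢ`. -/
def divergence {n : ℕ} (F : EuclideanSpace ℝ (Fin n) → EuclideanSpace ℝ (Fin n))
    (x : EuclideanSpace ℝ (Fin n)) : ℝ :=
  ∑ i, fderiv ℝ F x (EuclideanSpace.single i 1) i

/-- The vector field `a |∇u|^(p-2) ∇u` (which is zero where `∇u = 0`). -/
def pFlux {n : ℕ} (p : ℝ) (a u : EuclideanSpace ℝ (Fin n) → ℝ)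
    (x : EuclideanSpace ℝ (Fin n)) : EuclideanSpace ℝ (Fin n) :=
  (a x * ‖gradient u x‖ ^ (p - 2)) • gradient u x

/-- The integrand `a |∇(φ/u)|^p u^p` of the remainder term for `p ≥ 2`. -/
def remainderGe {n : ℕ} (p : ℝ) (a u φ : EuclideanSpace ℝ (Fin n) → ℝ)
    (x : EuclideanSpace ℝ (Fin n)) : ℝ :=
  a x * ‖gradient (fun y => φ y / u y) x‖ ^ p * u x ^ p

/-- The integrand `a |∇(φ/u)|² u² / (|(φ/u) ∇u| + |∇(φ/u)| u)^(2-p)` of the remainder term for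
`1 < p < 2`, with value `0` where the denominator (and hence the numerator) is zero. -/
def remainderLt {n : ℕ} (p : ℝ) (a u φ : EuclideanSpace ℝ (Fin n) → ℝ)
    (x : EuclideanSpace ℝ (Fin n)) : ℝ :=
  a x * ((‖gradient (fun y => φ y / u y) x‖ ^ 2 * u x ^ 2) /
    (‖(φ x / u x) • gradient u x‖ + ‖gradient (fun y => φ y / u y) x‖ * u x) ^ (2 - p))

/-- The inequality
`∫_Ω a |∇φ|^p ≥ ∫_Ω b |φ|^p + c ∫_Ω R + ∫_∂Ω β |φ|^p`, together with the facts that give all of its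
terms a meaning: every term is a convergent integral, except that `∫_Ω b |φ|^p`, whose positive
part converges, may be `-∞`. In that last case there is nothing more to say; otherwise
the inequality is one between real numbers. -/
def HardyInequality {n : ℕ} (Ω : Set (EuclideanSpace ℝ (Fin n))) (p : ℝ)
    (a b β φ : EuclideanSpace ℝ (Fin n) → ℝ) (c : ℝ) (R : EuclideanSpace ℝ (Fin n) → ℝ) : Prop :=
  IntegrableOn (fun x => a x * ‖gradient φ x‖ ^ p) Ω ∧
  IntegrableOn R Ω ∧
  Integrable (fun x => β x * |φ x| ^ p) (surfaceMeasure Ω) ∧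
  IntegrableOn (fun x => max (b x) 0 * |φ x| ^ p) Ω ∧
  (IntegrableOn (fun x => b x * |φ x| ^ p) Ω →
    (∫ x in Ω, a x * ‖gradient φ x‖ ^ p) ≥
      (∫ x in Ω, b x * |φ x| ^ p) + c * (∫ x in Ω, R x)
        + ∫ x, β x * |φ x| ^ p ∂(surfaceMeasure Ω))

end

/-! Put `F = a|∇u|^(p-2)∇u` and test the differential inequality with `ψ = |φ|^p u^(1-p)`. Writing
`∇φ = X + Y` with `X = (φ/u)∇u` and `Y = u∇(φ/u)`, a direct computation gives `∇ψ·F = a(|X|^p +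
p|X|^(p-2)⟨X,Y⟩)`, which is `a` times the tangent expansion of `|·|^p` at `X` evaluated at `X + Y`.
Quantitative convexity of `|·|^p` then bounds `a|∇φ|^p` below by `∇ψ·F` plus the remainder. For `p ≥
2` the gain `2^(1-p)|Y|^p` comes from a Clarkson inequality; for `1 < p < 2` the gain `p(p-1)/2 ·
|Y|²/(|X|+|Y|)^(2-p)` comes from the lower bound for the second derivative of `s^p` on a bounded
interval. Integrating, and using `∫ ψ div F + ∫ ∇ψ·F = ∫_∂Ω ψ F·ν` together with `ψ u^(p-1) =
|φ|^p`, yields the inequality.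

The analytic difficulty is this integration by parts. The hypothesis controls the divergence of `F`
only classically and almost everywhere, while for `p < 2` the field may fail to be `C¹` at critical
points of `u`. Replace `|∇u|^(p-2)` by `(|∇u|² + s)^((p-2)/2)` and let `s → 0`. The divergences of
the regularized fields are dominated uniformly in `s` by locally integrable quantities, of which the
only singular one is `|D²u||∇u|^(p-2)`. Its integrability is a statement about roots of smooth
functions: if `0 < α < 1` and `f` is smooth on a line, then `|f'||f|^(α-1)` is locally integrable,
with a bound depending only on finitely many derivatives of `f` (`lintegral_abs_deriv_mul_rpow_le`).
It is applied with `α = p - 1` to the partial derivatives of `u` along lines. On the critical set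
both the regularized and the limiting divergence vanish almost everywhere, because the derivative of
a function vanishes almost everywhere on its zero set.

The divergence theorem for `C¹` fields is proved separately. Smooth cutoffs of thin layers below a
graph give the flux through the graph, the area formula identifies the resulting measure with
Hausdorff measure, and a partition of unity globalizes. -/

/-! ### Convexity of real powers. -/

theorem Real.rpow_add_mul_sub_le_rpow {p s t : ℝ} (hp : 1 ≤ p) (hs : 0 ≤ s) (ht : 0 ≤ t) :
    t ^ p + p * t ^ (p - 1) * (s - t) ≤ s ^ p := by
  rcases ht.eq_or_lt with rfl | ht
  · rcases hp.eq_or_lt with rfl | hp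
    · simp
    · rw [Real.zero_rpow (by linarith), Real.zero_rpow (by linarith)]
      simpa using Real.rpow_nonneg hs p
  · have h := one_add_mul_self_le_rpow_one_add (s := s / t - 1)
      (by have := div_nonneg hs ht.le; linarith) hp
    rw [add_sub_cancel, Real.div_rpow hs ht.le, le_div_iff₀ (Real.rpow_pos_of_pos ht p)] at h
    have h1 : t ^ p = t ^ (p - 1) * t := by
      rw [← Real.rpow_add_one ht.ne']; ring_nf
    have h2 : (1 + p * (s / t - 1)) * t ^ p = t ^ p + p * t ^ (p - 1) * (s - t) := by
      rw [h1]; field_simp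
    linarith

/-- Bernoulli's inequality for exponents in `[0, 1]`, applied to `t / s`. -/
theorem Real.mul_sub_le_rpow_sub_rpow {q s t : ℝ} (hq : 0 ≤ q) (hq1 : q ≤ 1) (hs : 0 < s)
    (ht : 0 ≤ t) : q * s ^ (q - 1) * (s - t) ≤ s ^ q - t ^ q := by
  have h := rpow_one_add_le_one_add_mul_self (s := t / s - 1)
    (by have := div_nonneg ht hs.le; linarith) hq hq1
  rw [add_sub_cancel, Real.div_rpow ht hs.le, div_le_iff₀ (Real.rpow_pos_of_pos hs q)] at h
  have h1 : s ^ q = s ^ (q - 1) * s := by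
    rw [← Real.rpow_add_one hs.ne']; ring_nf
  have h2 : (1 + q * (t / s - 1)) * s ^ q = s ^ q - q * s ^ (q - 1) * (s - t) := by
    rw [h1]; field_simp; ring
  linarith

/-- The power function of exponent `p ∈ (1, 2)` is uniformly convex on `[0, M]`. -/
theorem Real.rpow_add_mul_sub_add_sq_le_rpow {p M s t : ℝ} (hp : 1 < p) (hp2 : p < 2)
    (hs : 0 ≤ s) (hsM : s ≤ M) (ht : 0 ≤ t) (htM : t ≤ M) :
    t ^ p + p * t ^ (p - 1) * (s - t) + p * (p - 1) / 2 * M ^ (p - 2) * (s - t) ^ 2 ≤ s ^ p := by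
  -- `D` is the gap in the inequality. It vanishes at `t`, and its derivative has the sign of `z -
  -- t`, so it is minimal there.
  set D : ℝ → ℝ := fun z => z ^ p - t ^ p - p * t ^ (p - 1) * (z - t) -
    p * (p - 1) / 2 * M ^ (p - 2) * (z - t) ^ 2 with hD
  set D' : ℝ → ℝ := fun z => p * (z ^ (p - 1) - t ^ (p - 1) - (p - 1) * M ^ (p - 2) * (z - t))
    with hD'
  have hd : ∀ z, HasDerivAt D (D' z) z := by
    intro z
    have h1 := Real.hasDerivAt_rpow_const (x := z) (p := p) (Or.inr hp.le)
    have h2 := (hasDerivAt_id z).sub_const t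
    have h3 := ((h1.sub_const (t ^ p)).sub (h2.const_mul (p * t ^ (p - 1)))).sub
      ((h2.pow 2).const_mul (p * (p - 1) / 2 * M ^ (p - 2)))
    refine h3.congr_deriv ?_
    simp only [hD', id_eq]
    norm_num
    ring
  -- On `[0, M]` the function `z^(p-1)` has slope at least `(p-1) M^(p-2)`, since `p - 2 ≤ 0`.
  have key : ∀ x y, 0 ≤ x → x < y → y ≤ M →
      (p - 1) * M ^ (p - 2) * (y - x) ≤ y ^ (p - 1) - x ^ (p - 1) := by
    intro x y hx hxy hy
    have h1 := Real.mul_sub_le_rpow_sub_rpow (q := p - 1) (by linarith) (by linarith)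
      (hx.trans_lt hxy) hx
    have h2 : M ^ (p - 2) ≤ y ^ (p - 2) :=
      Real.rpow_le_rpow_of_nonpos (hx.trans_lt hxy) hy (by linarith)
    rw [show p - 1 - 1 = p - 2 by ring] at h1
    refine le_trans ?_ h1
    have h3 : 0 ≤ y - x := by linarith
    have h4 : 0 ≤ p - 1 := by linarith
    gcongr
  have h0 : D t = 0 := by simp [hD]
  have hc : Continuous D := continuous_iff_continuousAt.2 fun z => (hd z).continuousAt
  suffices 0 ≤ D s by simp only [hD] at this; linarith
  rcases le_total t s with hts | hts
  · have hm : MonotoneOn D (Icc t M) := by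
      refine monotoneOn_of_deriv_nonneg (convex_Icc _ _) hc.continuousOn
        (fun z _ => (hd z).differentiableAt.differentiableWithinAt) fun z hz => ?_
      rw [interior_Icc] at hz
      rw [(hd z).deriv]
      exact mul_nonneg (by linarith) (by linarith [key t z ht hz.1 hz.2.le])
    rw [← h0]
    exact hm ⟨le_rfl, htM⟩ ⟨hts, hsM⟩ hts
  · have hm : AntitoneOn D (Icc 0 t) := by
      refine antitoneOn_of_deriv_nonpos (convex_Icc _ _) hc.continuousOn
        (fun z _ => (hd z).differentiableAt.differentiableWithinAt) fun z hz => ?_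
      rw [interior_Icc] at hz
      rw [(hd z).deriv]
      exact mul_nonpos_of_nonneg_of_nonpos (by linarith) (by linarith [key z t hz.1.le hz.2 htM])
    rw [← h0]
    exact hm ⟨hs, hts⟩ ⟨ht, le_rfl⟩ hts

/-! ### Quantitative convexity of the `p`-th power of a Hilbert norm. -/

section

variable {V : Type*} [NormedAddCommGroup V] [InnerProductSpace ℝ V]

/-- Cauchy–Schwarz for `⟨X, X + Y⟩`. It reduces the vector inequalities to scalar ones in `‖X‖` and
`‖X + Y‖`. -/
theorem rpow_sub_two_mul_inner_le {p : ℝ} (hp : 1 < p) (X Y : V) :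
    ‖X‖ ^ (p - 2) * inner ℝ X Y ≤ ‖X‖ ^ (p - 1) * (‖X + Y‖ - ‖X‖) := by
  rcases eq_or_ne X 0 with rfl | hX
  · simp [Real.zero_rpow (show p - 1 ≠ 0 by linarith)]
  · have hX := norm_pos_iff.2 hX
    have h1 : ‖X‖ ^ (p - 1) = ‖X‖ ^ (p - 2) * ‖X‖ := by
      rw [← Real.rpow_add_one hX.ne']; ring_nf
    rw [h1, mul_assoc]
    refine mul_le_mul_of_nonneg_left ?_ (Real.rpow_nonneg hX.le _)
    have h2 := real_inner_le_norm X (X + Y)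
    rw [inner_add_right, real_inner_self_eq_norm_sq] at h2
    linarith

/-- The tangent inequality for the convex function `‖·‖ ^ p`. -/
theorem norm_rpow_add_inner_le {p : ℝ} (hp : 1 < p) (X Y : V) :
    ‖X‖ ^ p + p * ‖X‖ ^ (p - 2) * inner ℝ X Y ≤ ‖X + Y‖ ^ p := by
  have h1 := Real.rpow_add_mul_sub_le_rpow hp.le (norm_nonneg (X + Y)) (norm_nonneg X)
  have h2 := mul_le_mul_of_nonneg_left (rpow_sub_two_mul_inner_le hp X Y) (by linarith : 0 ≤ p)
  linarith

/-- The parallelogram law for squared norms, combined with superadditivity and convexity of `s ↦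
s^(p/2)`. -/
theorem clarkson_of_two_le {p : ℝ} (hp : 2 ≤ p) (X Y : V) :
    2 * ‖X‖ ^ p + 2 * ‖Y‖ ^ p ≤ ‖X + Y‖ ^ p + ‖X - Y‖ ^ p := by
  have hsq : ∀ Z : V, ‖Z‖ ^ p = (‖Z‖ ^ 2) ^ (p / 2) := fun Z => by
    rw [← Real.rpow_natCast, ← Real.rpow_mul (norm_nonneg Z)]
    congr 1
    push_cast
    ring
  have h1 := Real.add_rpow_le_rpow_add (p := p / 2) (sq_nonneg ‖X‖) (sq_nonneg ‖Y‖) (by linarith)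
  have h2 := (convexOn_rpow (p := p / 2) (by linarith)).2 (mem_Ici.2 (sq_nonneg ‖X + Y‖))
    (mem_Ici.2 (sq_nonneg ‖X - Y‖)) (by norm_num : (0 : ℝ) ≤ 1 / 2)
    (by norm_num : (0 : ℝ) ≤ 1 / 2) (by norm_num)
  have h3 : (1 / 2 : ℝ) • ‖X + Y‖ ^ 2 + (1 / 2 : ℝ) • ‖X - Y‖ ^ 2 = ‖X‖ ^ 2 + ‖Y‖ ^ 2 := by
    have := parallelogram_law_with_norm ℝ X Y
    simp only [smul_eq_mul]
    nlinarith
  rw [h3] at h2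
  rw [hsq X, hsq Y, hsq (X + Y), hsq (X - Y)]
  simp only [smul_eq_mul] at h2
  linarith

/-- Clarkson's inequality for `X + Y/2` and `Y/2`, whose sum and difference are `X + Y` and `X`; the
midpoint term is then bounded below by the tangent inequality. -/
theorem norm_rpow_add_inner_add_le_of_two_le {p : ℝ} (hp : 2 ≤ p) (X Y : V) :
    ‖X‖ ^ p + p * ‖X‖ ^ (p - 2) * inner ℝ X Y + 2 * (1 / 2) ^ p * ‖Y‖ ^ p ≤ ‖X + Y‖ ^ p := by
  have h1 := clarkson_of_two_le hp (X + (1 / 2 : ℝ) • Y) ((1 / 2 : ℝ) • Y)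
  have h2 := norm_rpow_add_inner_le (by linarith : 1 < p) X ((1 / 2 : ℝ) • Y)
  rw [add_sub_cancel_right, add_assoc, ← add_smul, show (1 / 2 + 1 / 2 : ℝ) = 1 by norm_num,
    one_smul, norm_smul, Real.mul_rpow (norm_nonneg _) (norm_nonneg _), Real.norm_eq_abs,
    abs_of_pos (by norm_num)] at h1
  rw [real_inner_smul_right] at h2
  linarith

/-- The scalar inequality on `[0, ‖X‖ + ‖Y‖]` controls only the radial increment `‖X + Y‖ - ‖X‖`.
The rest of `‖Y‖²` is twice the Cauchy–Schwarz defect, and it is absorbed by the slack in the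
tangent inequality, where the defect carries the larger weight `p‖X‖^(p-2)`. -/
theorem norm_rpow_add_inner_add_le_of_lt_two {p : ℝ} (hp : 1 < p) (hp2 : p < 2) (X Y : V) :
    ‖X‖ ^ p + p * ‖X‖ ^ (p - 2) * inner ℝ X Y +
      p * (p - 1) / 2 * (‖Y‖ ^ 2 / (‖X‖ + ‖Y‖) ^ (2 - p)) ≤ ‖X + Y‖ ^ p := by
  rcases eq_or_ne X 0 with rfl | hX
  · rcases eq_or_ne Y 0 with rfl | hY
    · simp
    · have hY := norm_pos_iff.2 hY
      have h1 : ‖Y‖ ^ 2 / ‖Y‖ ^ (2 - p) = ‖Y‖ ^ p := by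
        rw [← Real.rpow_natCast, ← Real.rpow_sub hY]
        congr 1
        push_cast
        ring
      simp only [norm_zero, zero_add, inner_zero_left, mul_zero, h1,
        Real.zero_rpow (show p ≠ 0 by linarith)]
      have : 0 ≤ ‖Y‖ ^ p := by positivity
      exact mul_le_of_le_one_left this (by nlinarith)
  have hX' := norm_pos_iff.2 hX
  set M := ‖X‖ + ‖Y‖ with hM
  have hM0 : 0 < M := by positivity
  have h1 := Real.rpow_add_mul_sub_add_sq_le_rpow (M := M) hp hp2 (norm_nonneg (X + Y))
    (norm_add_le X Y) (norm_nonneg X) (by rw [hM]; linarith [norm_nonneg Y])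
  have hr : M ^ (p - 2) ≤ ‖X‖ ^ (p - 2) :=
    Real.rpow_le_rpow_of_nonpos hX' (by rw [hM]; linarith [norm_nonneg Y]) (by linarith)
  have hq : ‖Y‖ ^ 2 / M ^ (2 - p) = M ^ (p - 2) * ‖Y‖ ^ 2 := by
    rw [show 2 - p = -(p - 2) by ring, Real.rpow_neg hM0.le, div_inv_eq_mul, mul_comm]
  rw [hq]
  have hi : inner ℝ X Y ≤ ‖X‖ * (‖X + Y‖ - ‖X‖) := by
    have h2 := real_inner_le_norm X (X + Y)
    rw [inner_add_right, real_inner_self_eq_norm_sq] at h2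
    linarith
  have hp1 : ‖X‖ ^ (p - 1) = ‖X‖ ^ (p - 2) * ‖X‖ := by
    rw [← Real.rpow_add_one hX'.ne']; ring_nf
  -- Splitting of `‖Y‖²` into the squared radial increment and twice the Cauchy–Schwarz defect.
  have hs : ‖Y‖ ^ 2 = (‖X + Y‖ - ‖X‖) ^ 2 + 2 * (‖X‖ * (‖X + Y‖ - ‖X‖) - inner ℝ X Y) := by
    have := norm_add_sq_real X Y
    linarith
  rw [hs]
  rw [hp1] at h1
  have hk : (p - 1) * M ^ (p - 2) ≤ ‖X‖ ^ (p - 2) := by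
    have : 0 ≤ M ^ (p - 2) := by positivity
    nlinarith
  have := mul_nonneg (mul_nonneg (by linarith : (0 : ℝ) ≤ p) (sub_nonneg.2 hk)) (sub_nonneg.2 hi)
  linarith

end

/-! ### Integrability of derivatives of roots of smooth functions of one variable. -/

section RootsOfSmoothFunctions

theorem continuous_abs_add_rpow {α ε : ℝ} (hε : 0 < ε) :
    Continuous fun s : ℝ => (|s| + ε) ^ (α - 1) :=
  (continuous_abs.add continuous_const).rpow_const fun s => Or.inl (by
    have := abs_nonneg s; exact (by linarith : 0 < |s| + ε).ne')

/-- Explicit antiderivative and subadditivity of `x ↦ x^α`. The bound does not involve `ε`. -/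
theorem integral_abs_add_rpow_le_of_nonneg {α ε : ℝ} (hα : 0 < α) (hα1 : α ≤ 1) (hε : 0 < ε)
    {s t : ℝ} (hs : 0 ≤ s) (hst : s ≤ t) :
    ∫ x in s..t, (|x| + ε) ^ (α - 1) ≤ 1 / α * (t - s) ^ α := by
  have h1 : ∫ x in s..t, (|x| + ε) ^ (α - 1) = ∫ x in s..t, (x + ε) ^ (α - 1) := by
    refine intervalIntegral.integral_congr fun x hx => ?_
    rw [uIcc_of_le hst] at hx
    simp only [abs_of_nonneg (hs.trans hx.1)]
  rw [h1, intervalIntegral.integral_comp_add_right (fun x => x ^ (α - 1)),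
    integral_rpow (Or.inl (by linarith)), sub_add_cancel, div_eq_inv_mul, one_div]
  refine mul_le_mul_of_nonneg_left ?_ (by positivity)
  have h2 := Real.rpow_add_le_add_rpow (sub_nonneg.2 hst) (by linarith : 0 ≤ s + ε) hα.le hα1
  rw [show t - s + (s + ε) = t + ε by ring] at h2
  linarith

/-- An interval containing `0` is cut there, which costs the factor `2`. -/
theorem integral_abs_add_rpow_le {α ε : ℝ} (hα : 0 < α) (hα1 : α ≤ 1) (hε : 0 < ε)
    {s t : ℝ} (hst : s ≤ t) :
    ∫ x in s..t, (|x| + ε) ^ (α - 1) ≤ 2 / α * (t - s) ^ α := by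
  have hneg : ∀ {s t : ℝ}, t ≤ 0 → s ≤ t →
      ∫ x in s..t, (|x| + ε) ^ (α - 1) ≤ 1 / α * (t - s) ^ α := by
    intro s t ht hst
    have h := integral_abs_add_rpow_le_of_nonneg hα hα1 hε (neg_nonneg.2 ht) (neg_le_neg hst)
    have h1 := intervalIntegral.integral_comp_neg (a := s) (b := t)
      (fun x : ℝ => (|x| + ε) ^ (α - 1))
    simp only [abs_neg] at h1
    rw [h1, show t - s = -s - -t by ring]
    exact h
  have hp : ∀ x : ℝ, 0 ≤ x → 1 / α * x ^ α ≤ 2 / α * x ^ α := fun x hx => by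
    have := Real.rpow_nonneg hx α
    gcongr
    norm_num
  rcases le_total 0 s with h | h
  · exact (integral_abs_add_rpow_le_of_nonneg hα hα1 hε h hst).trans (hp _ (by linarith))
  rcases le_total t 0 with h' | h'
  · exact (hneg h' hst).trans (hp _ (by linarith))
  have hi : ∀ a b : ℝ, IntervalIntegrable (fun x : ℝ => (|x| + ε) ^ (α - 1)) volume a b :=
    fun a b => (continuous_abs_add_rpow hε).intervalIntegrable a b
  rw [← intervalIntegral.integral_add_adjacent_intervals (hi s 0) (hi 0 t)]
  have h1 := hneg le_rfl h
  have h2 := integral_abs_add_rpow_le_of_nonneg hα hα1 hε le_rfl h'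
  have h3 : (0 - s) ^ α ≤ (t - s) ^ α := Real.rpow_le_rpow (by linarith) (by linarith) hα.le
  have h4 : (t - 0) ^ α ≤ (t - s) ^ α := Real.rpow_le_rpow (by linarith) (by linarith) hα.le
  have h5 : 0 < 1 / α := by positivity
  calc _ ≤ 1 / α * (0 - s) ^ α + 1 / α * (t - 0) ^ α := add_le_add h1 h2
    _ ≤ 1 / α * (t - s) ^ α + 1 / α * (t - s) ^ α := by gcongr
    _ = _ := by ring

/-- Substituting `s = f x` on an interval of monotonicity leaves an integral that sees only the
oscillation of `f`. -/
theorem integral_abs_deriv_mul_le_of_nonneg {α ε : ℝ} (hα : 0 < α) (hα1 : α ≤ 1) (hε : 0 < ε)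
    {f f' : ℝ → ℝ} (hf : ∀ t, HasDerivAt f (f' t) t) (hf' : Continuous f') {c d δ : ℝ}
    (hcd : c ≤ d) (h0 : ∀ x ∈ Icc c d, 0 ≤ f' x) (hδ : |f d - f c| ≤ δ) :
    ∫ x in c..d, |f' x| * (|f x| + ε) ^ (α - 1) ≤ 2 / α * δ ^ α := by
  have h1 : ∫ x in c..d, |f' x| * (|f x| + ε) ^ (α - 1) =
      ∫ x in c..d, ((fun s => (|s| + ε) ^ (α - 1)) ∘ f) x * f' x := by
    refine intervalIntegral.integral_congr fun x hx => ?_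
    rw [uIcc_of_le hcd] at hx
    simp only [abs_of_nonneg (h0 x hx), Function.comp, mul_comm]
  rw [h1, intervalIntegral.integral_comp_mul_deriv (fun x _ => hf x) hf'.continuousOn
    (continuous_abs_add_rpow hε)]
  have hm : f c ≤ f d := by
    have hc : Continuous f := continuous_iff_continuousAt.2 fun z => (hf z).continuousAt
    refine monotoneOn_of_deriv_nonneg (convex_Icc c d) hc.continuousOn
      (fun z _ => (hf z).differentiableAt.differentiableWithinAt) (fun z hz => ?_)
      (left_mem_Icc.2 hcd) (right_mem_Icc.2 hcd) hcd
    rw [(hf z).deriv]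
    exact h0 z (interior_subset hz)
  refine (integral_abs_add_rpow_le hα hα1 hε hm).trans ?_
  rw [abs_of_nonneg (sub_nonneg.2 hm)] at hδ
  have := Real.rpow_le_rpow (sub_nonneg.2 hm) hδ hα.le
  gcongr

theorem integral_abs_deriv_mul_le_of_ne_zero {α ε : ℝ} (hα : 0 < α) (hα1 : α ≤ 1) (hε : 0 < ε)
    {f f' : ℝ → ℝ} (hf : ∀ t, HasDerivAt f (f' t) t) (hf' : Continuous f') {c d δ : ℝ}
    (hcd : c < d) (h0 : ∀ x ∈ Ioo c d, f' x ≠ 0) (hδ : |f d - f c| ≤ δ) :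
    ∫ x in c..d, |f' x| * (|f x| + ε) ^ (α - 1) ≤ 2 / α * δ ^ α := by
  have hcl : ∀ {g : ℝ → ℝ}, Continuous g → (∀ x ∈ Ioo c d, 0 ≤ g x) → ∀ x ∈ Icc c d, 0 ≤ g x := by
    intro g hg h x hx
    rw [← closure_Ioo hcd.ne] at hx
    exact closure_minimal (t := {x | 0 ≤ g x}) h (isClosed_le continuous_const hg) hx
  by_cases hpos : ∀ x ∈ Ioo c d, 0 ≤ f' x
  · exact integral_abs_deriv_mul_le_of_nonneg hα hα1 hε hf hf' hcd.le (hcl hf' hpos) hδ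
  · push Not at hpos
    obtain ⟨y, hy, hy0⟩ := hpos
    have hneg : ∀ x ∈ Ioo c d, 0 ≤ -f' x := by
      intro x hx
      by_contra hcon
      have hsub := isPreconnected_Ioo.intermediate_value hy hx hf'.continuousOn
      obtain ⟨z, hz, hz0⟩ := hsub ⟨hy0.le, by linarith⟩
      exact h0 z hz hz0
    have h := integral_abs_deriv_mul_le_of_nonneg (f := fun t => -f t) (f' := fun t => -f' t)
      hα hα1 hε (fun t => (hf t).neg) hf'.neg hcd.le (hcl hf'.neg hneg) (δ := δ)
      (by rw [← abs_neg]; convert hδ using 2; ring)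
    simpa only [abs_neg] using h

variable {f : ℕ → ℝ → ℝ}

theorem continuous_of_forall_hasDerivAt (hf : ∀ k t, HasDerivAt (f k) (f (k + 1) t) t) (k : ℕ) :
    Continuous (f k) :=
  continuous_iff_continuousAt.2 fun z => (hf k z).continuousAt

theorem continuous_abs_deriv_mul {α ε : ℝ} (hε : 0 < ε)
    (hf : ∀ k t, HasDerivAt (f k) (f (k + 1) t) t) :
    Continuous fun x => |f 1 x| * (|f 0 x| + ε) ^ (α - 1) :=
  (continuous_of_forall_hasDerivAt hf 1).abs.mul
    ((continuous_abs_add_rpow hε).comp (continuous_of_forall_hasDerivAt hf 0))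

/-- If some derivative of order `j + 1` does not vanish then there are at most `2 ^ j` intervals of
monotonicity. -/
theorem integral_abs_deriv_mul_le_of_iterated_ne_zero {α ε : ℝ} (hα : 0 < α) (hα1 : α ≤ 1)
    (hε : 0 < ε) (hf : ∀ k t, HasDerivAt (f k) (f (k + 1) t) t) {δ : ℝ} (j : ℕ) {c d : ℝ}
    (hcd : c < d) (h0 : ∀ x ∈ Ioo c d, f (j + 1) x ≠ 0)
    (hδ : ∀ x ∈ Icc c d, ∀ y ∈ Icc c d, |f 0 x - f 0 y| ≤ δ) :
    ∫ x in c..d, |f 1 x| * (|f 0 x| + ε) ^ (α - 1) ≤ 2 ^ j * (2 / α * δ ^ α) := by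
  have hδ0 : 0 ≤ δ := (abs_nonneg _).trans
    (hδ c (left_mem_Icc.2 hcd.le) c (left_mem_Icc.2 hcd.le))
  induction j generalizing c d with
  | zero =>
    rw [pow_zero, one_mul]
    exact integral_abs_deriv_mul_le_of_ne_zero hα hα1 hε (hf 0)
      (continuous_of_forall_hasDerivAt hf 1) hcd h0
      (hδ d (right_mem_Icc.2 hcd.le) c (left_mem_Icc.2 hcd.le))
  | succ j ih =>
    have hW : 0 ≤ 2 ^ j * (2 / α * δ ^ α) := by positivity
    by_cases hz : ∀ x ∈ Ioo c d, f (j + 1) x ≠ 0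
    · refine (ih hcd hz hδ).trans ?_
      rw [pow_succ]
      linarith
    · push Not at hz
      obtain ⟨z, hz, hz0⟩ := hz
      -- By Rolle, the derivative of order `j + 1` has at most one zero, because the next one has
      -- none. Cutting at `z` doubles the constant.
      have hne : ∀ x ∈ Ioo c d, x ≠ z → f (j + 1) x ≠ 0 := by
        intro x hx hxz hx0
        rcases lt_or_gt_of_ne hxz with hlt | hlt
        · obtain ⟨y, hy, hy0⟩ := exists_hasDerivAt_eq_zero hlt
            (continuous_of_forall_hasDerivAt hf (j + 1)).continuousOn (hx0.trans hz0.symm)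
            (fun t _ => hf (j + 1) t)
          exact h0 y ⟨hx.1.trans hy.1, hy.2.trans hz.2⟩ hy0
        · obtain ⟨y, hy, hy0⟩ := exists_hasDerivAt_eq_zero hlt
            (continuous_of_forall_hasDerivAt hf (j + 1)).continuousOn (hz0.trans hx0.symm)
            (fun t _ => hf (j + 1) t)
          exact h0 y ⟨hz.1.trans hy.1, hy.2.trans hx.2⟩ hy0
      have h1 := ih hz.1 (fun x hx => hne x ⟨hx.1, hx.2.trans hz.2⟩ hx.2.ne)
        (fun x hx y hy => hδ x ⟨hx.1, hx.2.trans hz.2.le⟩ y ⟨hy.1, hy.2.trans hz.2.le⟩)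
      have h2 := ih hz.2 (fun x hx => hne x ⟨hz.1.trans hx.1, hx.2⟩ hx.1.ne')
        (fun x hx y hy => hδ x ⟨hz.1.le.trans hx.1, hx.2⟩ y ⟨hz.1.le.trans hy.1, hy.2⟩)
      have hc := continuous_abs_deriv_mul (α := α) hε hf
      rw [← intervalIntegral.integral_add_adjacent_intervals (hc.intervalIntegrable c z)
        (hc.intervalIntegrable z d), pow_succ]
      linarith

theorem abs_sub_le_of_abs_deriv_le {g g' : ℝ → ℝ} (hg : ∀ t, HasDerivAt g (g' t) t) {c ℓ B : ℝ}
    (hB : ∀ x ∈ Icc c (c + ℓ), |g' x| ≤ B) {x y : ℝ} (hx : x ∈ Icc c (c + ℓ))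
    (hy : y ∈ Icc c (c + ℓ)) : |g x - g y| ≤ B * ℓ := by
  have h := (convex_Icc c (c + ℓ)).norm_image_sub_le_of_norm_hasDerivWithin_le
    (fun t _ => (hg t).hasDerivWithinAt) (fun t ht => hB t ht) hy hx
  refine h.trans ?_
  have hB0 : 0 ≤ B := (abs_nonneg _).trans (hB x hx)
  refine mul_le_mul_of_nonneg_left ?_ hB0
  rw [Real.norm_eq_abs, abs_le]
  constructor <;> linarith [hx.1, hx.2, hy.1, hy.2]

/-- Downward induction on the order: a derivative with a zero in the interval is at most `ℓ` times
the bound for the next derivative. -/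
theorem abs_iterated_deriv_le_of_exists_zero (hf : ∀ k t, HasDerivAt (f k) (f (k + 1) t) t) {m : ℕ}
    {M c ℓ : ℝ} (hM : ∀ x ∈ Icc c (c + ℓ), |f m x| ≤ M)
    (hz : ∀ k, 1 ≤ k → k < m → ∃ z ∈ Ioo c (c + ℓ), f k z = 0) (i : ℕ) (hi : i + 1 ≤ m) :
    ∀ x ∈ Icc c (c + ℓ), |f (m - i) x| ≤ M * ℓ ^ i := by
  induction i with
  | zero => simpa using hM
  | succ i ih =>
    intro x hx
    have h := ih (by omega)
    obtain ⟨z, hz, hz0⟩ := hz (m - (i + 1)) (by omega) (by omega)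
    have hk : m - i = m - (i + 1) + 1 := by omega
    rw [hk] at h
    have := abs_sub_le_of_abs_deriv_le (hf (m - (i + 1))) h hx (Ioo_subset_Icc_self hz)
    rw [hz0, sub_zero] at this
    rw [pow_succ, ← mul_assoc]
    exact this

/-- Stopping-time bisection. If some derivative of order `1, …, m + 1` has no zero on the interval,
there are boundedly many monotone pieces, each of oscillation at most a constant times `ℓ^(m+2)`,
and the process stops. Otherwise all of these derivatives have zeros, `f'` is at most `M ℓ^(m+1)`,
and both halves inherit the hypothesis. After `K` bisections the intervals still undecided are
estimated crudely using `ε`, which gives the last term. -/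
theorem integral_abs_deriv_mul_le_dyadic {α ε : ℝ} (hα : 0 < α) (hα1 : α ≤ 1)
    (hε : 0 < ε) (hf : ∀ k t, HasDerivAt (f k) (f (k + 1) t) t) {m : ℕ} {M : ℝ}
    (hM0 : 0 ≤ M) (hmα : 1 ≤ (m + 2 : ℕ) * α) (K : ℕ) {c ℓ : ℝ} (hℓ : 0 < ℓ)
    (hM : ∀ x ∈ Icc c (c + ℓ), |f (m + 2) x| ≤ M)
    (h1 : ∀ x ∈ Icc c (c + ℓ), |f 1 x| ≤ M * (2 * ℓ) ^ (m + 1)) :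
    ∫ x in c..(c + ℓ), |f 1 x| * (|f 0 x| + ε) ^ (α - 1) ≤
      2 ^ m * (2 / α * (M * 2 ^ (m + 1)) ^ α) * ℓ ^ ((m + 2 : ℕ) * α) +
      ε ^ (α - 1) * M * 2 ^ (m + 1) * ℓ ^ (m + 2) / 2 ^ (K * (m + 1)) := by
  have hc := continuous_abs_deriv_mul (α := α) hε hf
  induction K generalizing c ℓ with
  | zero =>
    have hb : ∀ x ∈ Icc c (c + ℓ), |f 1 x| * (|f 0 x| + ε) ^ (α - 1) ≤
        M * (2 * ℓ) ^ (m + 1) * ε ^ (α - 1) := by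
      intro x hx
      have hr : (|f 0 x| + ε) ^ (α - 1) ≤ ε ^ (α - 1) :=
        Real.rpow_le_rpow_of_nonpos hε (by linarith [abs_nonneg (f 0 x)]) (by linarith)
      exact mul_le_mul (h1 x hx) hr (by positivity) (by positivity)
    have := intervalIntegral.integral_mono_on (by linarith : c ≤ c + ℓ)
      (hc.intervalIntegrable _ _) (intervalIntegrable_const (μ := volume)) hb
    rw [intervalIntegral.integral_const, smul_eq_mul, add_sub_cancel_left] at this
    have hpos : 0 ≤ 2 ^ m * (2 / α * (M * 2 ^ (m + 1)) ^ α) * ℓ ^ ((m + 2 : ℕ) * α) := by positivity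
    refine this.trans ((le_of_eq ?_).trans (le_add_of_nonneg_left hpos))
    rw [mul_pow, Nat.zero_mul, pow_zero]
    ring
  | succ K ih =>
    have hE : 0 ≤ ε ^ (α - 1) * M * 2 ^ (m + 1) * ℓ ^ (m + 2) / 2 ^ ((K + 1) * (m + 1)) := by
      positivity
    -- The stopping criterion: if it holds, the oscillation is at most `M (2ℓ)^(m+1) ℓ` and there
    -- are at most `2^m` monotone pieces.
    by_cases hgood : ∃ k, 1 ≤ k ∧ k < m + 2 ∧ ∀ x ∈ Ioo c (c + ℓ), f k x ≠ 0
    · obtain ⟨k, hk1, hkm, hk⟩ := hgood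
      obtain ⟨j, rfl⟩ := Nat.exists_eq_add_of_le' hk1
      have h := integral_abs_deriv_mul_le_of_iterated_ne_zero hα hα1 hε hf j
        (by linarith : c < c + ℓ) hk (fun x hx y hy => abs_sub_le_of_abs_deriv_le (hf 0) h1 hx hy)
      refine h.trans (le_trans ?_ (le_add_of_nonneg_right hE))
      have e1 : M * (2 * ℓ) ^ (m + 1) * ℓ = M * 2 ^ (m + 1) * ℓ ^ (m + 2) := by
        rw [mul_pow]; ring
      rw [e1, Real.mul_rpow (by positivity) (by positivity), ← Real.rpow_natCast ℓ (m + 2),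
        ← Real.rpow_mul hℓ.le]
      have : (2 : ℝ) ^ j ≤ 2 ^ m := pow_le_pow_right₀ (by norm_num) (by omega)
      calc _ = 2 ^ j * (2 / α * (M * 2 ^ (m + 1)) ^ α * ℓ ^ ((m + 2 : ℕ) * α)) := by ring
        _ ≤ 2 ^ m * (2 / α * (M * 2 ^ (m + 1)) ^ α * ℓ ^ ((m + 2 : ℕ) * α)) := by gcongr
        _ = _ := by ring
    · push Not at hgood
      have hd := abs_iterated_deriv_le_of_exists_zero hf hM
        (fun k hk1 hk2 => hgood k hk1 hk2) (m + 1) le_rfl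
      rw [show m + 2 - (m + 1) = 1 by omega] at hd
      have e2 : 2 * (ℓ / 2) = ℓ := by ring
      have e3 : c + ℓ / 2 + ℓ / 2 = c + ℓ := by ring
      have i1 := ih (c := c) (ℓ := ℓ / 2) (by linarith)
        (fun x hx => hM x ⟨hx.1, hx.2.trans (by linarith)⟩)
        (fun x hx => by rw [e2]; exact hd x ⟨hx.1, hx.2.trans (by linarith)⟩)
      have i2 := ih (c := c + ℓ / 2) (ℓ := ℓ / 2) (by linarith)
        (fun x hx => by rw [e3] at hx; exact hM x ⟨by linarith [hx.1], hx.2⟩)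
        (fun x hx => by rw [e2]; rw [e3] at hx; exact hd x ⟨by linarith [hx.1], hx.2⟩)
      rw [e3] at i2
      rw [← intervalIntegral.integral_add_adjacent_intervals
        (hc.intervalIntegrable c (c + ℓ / 2)) (hc.intervalIntegrable (c + ℓ / 2) (c + ℓ))]
      -- Since `(m + 2)α ≥ 1`, the main term for the two halves sums to at most the main term for
      -- the whole, so its constant does not grow under bisection.
      have hhalf : 2 * (ℓ / 2) ^ ((m + 2 : ℕ) * α) ≤ ℓ ^ ((m + 2 : ℕ) * α) := by
        rw [Real.div_rpow hℓ.le (by norm_num), ← mul_div_assoc, div_le_iff₀ (by positivity),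
          mul_comm]
        have : (2 : ℝ) ≤ 2 ^ ((m + 2 : ℕ) * α) := by
          conv_lhs => rw [← Real.rpow_one 2]
          exact Real.rpow_le_rpow_of_exponent_le (by norm_num) hmα
        gcongr
      have hC : 0 ≤ 2 ^ m * (2 / α * (M * 2 ^ (m + 1)) ^ α) := by positivity
      -- The crude term gains `2 · 2^(-(m+2)) = 2^(-(m+1))` at each bisection.
      have e4 : 2 * (ε ^ (α - 1) * M * 2 ^ (m + 1) * (ℓ / 2) ^ (m + 2) / 2 ^ (K * (m + 1))) =
          ε ^ (α - 1) * M * 2 ^ (m + 1) * ℓ ^ (m + 2) / 2 ^ ((K + 1) * (m + 1)) := by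
        rw [add_mul K, one_mul, pow_add 2 (K * (m + 1)), div_pow, pow_succ 2 (m + 1)]
        field_simp
      have := mul_le_mul_of_nonneg_left hhalf hC
      linarith

/-- With `ε` fixed, the number of bisections tends to infinity and the crude term disappears; the
surviving bound is free of `ε`, so Fatou's lemma can later remove `ε` from the integrand. -/
theorem integral_abs_deriv_mul_le {α ε : ℝ} (hα : 0 < α) (hα1 : α ≤ 1)
    (hε : 0 < ε) (hf : ∀ k t, HasDerivAt (f k) (f (k + 1) t) t) {m : ℕ} {M : ℝ}
    (hmα : 1 ≤ (m + 2 : ℕ) * α) (hM : ∀ x ∈ Icc (0 : ℝ) 1, |f (m + 2) x| ≤ M)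
    (h1 : ∀ x ∈ Icc (0 : ℝ) 1, |f 1 x| ≤ M) :
    ∫ x in (0 : ℝ)..1, |f 1 x| * (|f 0 x| + ε) ^ (α - 1) ≤
      2 ^ m * (2 / α * (M * 2 ^ (m + 1)) ^ α) := by
  have hM0 : 0 ≤ M := (abs_nonneg _).trans (h1 0 (by simp))
  have h : ∀ K : ℕ, ∫ x in (0 : ℝ)..1, |f 1 x| * (|f 0 x| + ε) ^ (α - 1) ≤
      2 ^ m * (2 / α * (M * 2 ^ (m + 1)) ^ α) +
        ε ^ (α - 1) * M * 2 ^ (m + 1) * ((1 / 2) ^ (m + 1)) ^ K := by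
    intro K
    have h := integral_abs_deriv_mul_le_dyadic hα hα1 hε hf hM0 hmα K (c := 0) one_pos
      (by simpa using hM) (fun x hx => by
        rw [zero_add] at hx
        refine (h1 x hx).trans (le_mul_of_one_le_right hM0 ?_)
        exact one_le_pow₀ (by norm_num))
    rw [zero_add, Real.one_rpow, mul_one, one_pow, mul_one] at h
    refine h.trans (le_of_eq ?_)
    rw [← pow_mul, mul_comm (m + 1) K, one_div, inv_pow,
      div_eq_mul_inv (ε ^ (α - 1) * M * 2 ^ (m + 1))]
  have := (tendsto_pow_atTop_nhds_zero_of_lt_one (r := ((1 / 2 : ℝ)) ^ (m + 1)) (by positivity)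
    (pow_lt_one₀ (by norm_num) (by norm_num) (by omega))).const_mul
      (ε ^ (α - 1) * M * 2 ^ (m + 1))
  have h' := this.const_add (2 ^ m * (2 / α * (M * 2 ^ (m + 1)) ^ α))
  rw [mul_zero, add_zero] at h'
  exact ge_of_tendsto' h' h

/-- The derivative of `|f| ^ α` is integrable, with a bound depending only on the derivatives of
`f` of orders `1` and `m + 2 ≥ 1 / α`. -/
theorem lintegral_abs_deriv_mul_rpow_le {α : ℝ} (hα : 0 < α) (hα1 : α < 1)
    (hf : ∀ k t, HasDerivAt (f k) (f (k + 1) t) t) {m : ℕ} {M : ℝ}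
    (hmα : 1 ≤ (m + 2 : ℕ) * α) (hM : ∀ x ∈ Icc (0 : ℝ) 1, |f (m + 2) x| ≤ M)
    (h1 : ∀ x ∈ Icc (0 : ℝ) 1, |f 1 x| ≤ M) :
    ∫⁻ x in Icc (0 : ℝ) 1, ENNReal.ofReal (|f 1 x| * |f 0 x| ^ (α - 1)) ≤
      ENNReal.ofReal (2 ^ m * (2 / α * (M * 2 ^ (m + 1)) ^ α)) := by
  set e : ℕ → ℝ := fun j => 1 / ((j : ℝ) + 1)
  have he : ∀ j, 0 < e j := fun j => by positivity
  -- At zeros of `f 0` the left side is `0`, because `0 ^ (α - 1) = 0` for the total power function.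
  have hpt : ∀ x, ENNReal.ofReal (|f 1 x| * |f 0 x| ^ (α - 1)) ≤
      liminf (fun j => ENNReal.ofReal (|f 1 x| * (|f 0 x| + e j) ^ (α - 1))) atTop := by
    intro x
    rcases eq_or_ne (f 0 x) 0 with h | h
    · simp [h, Real.zero_rpow (show α - 1 ≠ 0 by linarith)]
    · refine le_of_eq (Tendsto.liminf_eq ?_).symm
      refine ENNReal.tendsto_ofReal (Tendsto.const_mul _ ?_)
      have ht : Tendsto (fun j => |f 0 x| + e j) atTop (𝓝 (|f 0 x| + 0)) :=
        tendsto_one_div_add_atTop_nhds_zero_nat.const_add _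
      rw [add_zero] at ht
      exact ht.rpow_const (Or.inl (abs_pos.2 h).ne')
  calc _ ≤ ∫⁻ x in Icc (0 : ℝ) 1,
        liminf (fun j => ENNReal.ofReal (|f 1 x| * (|f 0 x| + e j) ^ (α - 1))) atTop :=
        lintegral_mono hpt
    _ ≤ liminf (fun j => ∫⁻ x in Icc (0 : ℝ) 1,
        ENNReal.ofReal (|f 1 x| * (|f 0 x| + e j) ^ (α - 1))) atTop :=
        lintegral_liminf_le fun j =>
          (continuous_abs_deriv_mul (he j) hf).measurable.ennreal_ofReal
    _ ≤ _ := by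
      refine (liminf_le_liminf (Eventually.of_forall fun j => ?_)).trans (liminf_const _).le
      rw [← ofReal_integral_eq_lintegral_ofReal
        ((continuous_abs_deriv_mul (he j) hf).continuousOn.integrableOn_Icc)
        (Eventually.of_forall fun x => by have := he j; positivity),
        integral_Icc_eq_integral_Ioc, ← intervalIntegral.integral_of_le zero_le_one]
      exact ENNReal.ofReal_le_ofReal (integral_abs_deriv_mul_le hα hα1.le (he j) hf hmα hM h1)

end RootsOfSmoothFunctions

/-! ### From lines to space by averaging over segments. -/

section LineAverages

theorem contDiff_iterate_fderiv_apply {V : Type*} [NormedAddCommGroup V] [NormedSpace ℝ V]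
    {v : V → ℝ} (hv : ContDiff ℝ ∞ v) (e : V) (k : ℕ) :
    ContDiff ℝ ∞ ((fun (w : V → ℝ) x => fderiv ℝ w x e)^[k] v) := by
  induction k with
  | zero => exact hv
  | succ k ih =>
    rw [Function.iterate_succ_apply']
    exact (ih.fderiv_right (by simp)).clm_apply contDiff_const

variable {V : Type*} [NormedAddCommGroup V] [NormedSpace ℝ V] [MeasurableSpace V] [BorelSpace V]
  [FiniteDimensional ℝ V] {μ : Measure V} [μ.IsAddHaarMeasure]

/-- Tonelli and translation invariance. An estimate on unit segments with a uniform constant thus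
becomes an estimate in space. -/
theorem lintegral_eq_lintegral_lintegral_add_smul (e : V) {h : V → ENNReal} (hh : Measurable h) :
    ∫⁻ x, h x ∂μ = ∫⁻ x, (∫⁻ t in Icc (0 : ℝ) 1, h (x + t • e)) ∂μ := by
  have hm : Measurable (Function.uncurry fun (x : V) (t : ℝ) => h (x + t • e)) :=
    hh.comp (by fun_prop)
  rw [lintegral_lintegral_swap hm.aemeasurable]
  simp [lintegral_add_right_eq_self]

theorem measure_eq_zero_of_countable_lines (e : V) {A : Set V} (hA : MeasurableSet A)
    (hc : ∀ x, {t : ℝ | x + t • e ∈ A}.Countable) : μ A = 0 := by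
  rw [← lintegral_indicator_one hA,
    lintegral_eq_lintegral_lintegral_add_smul e (measurable_one.indicator hA)]
  refine (lintegral_congr fun x => ?_).trans lintegral_zero
  have hm : Measurable fun t : ℝ => A.indicator (1 : V → ENNReal) (x + t • e) :=
    (measurable_one.indicator hA).comp (by fun_prop)
  rw [lintegral_eq_zero_iff hm]
  refine ae_restrict_of_ae ?_
  filter_upwards [(hc x).ae_notMem volume] with t ht
  simpa using ht

/-- Zeros with nonzero derivative are isolated, and a set of reals isolated from the right is
countable. -/
theorem countable_setOf_eq_zero_of_hasDerivAt_ne_zero (g : ℝ → ℝ) :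
    {t : ℝ | g t = 0 ∧ ∃ g', g' ≠ 0 ∧ HasDerivAt g g' t}.Countable := by
  set s := {t : ℝ | g t = 0 ∧ ∃ g', g' ≠ 0 ∧ HasDerivAt g g' t}
  have hs : s ⊆ {t ∈ s | 𝓝[s ∩ Ioi t] t = ⊥} := ?_
  · exact countable_setOfPred_isolated_right_within.mono hs
  refine fun t ht => ⟨ht, ?_⟩
  obtain ⟨h0, g', hg', hd⟩ := ht
  have h := hd.eventually_ne (c := 0) hg'
  rw [eventually_nhdsWithin_iff] at h
  rw [← empty_mem_iff_bot, mem_nhdsWithin_iff_eventually]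
  filter_upwards [h] with z hz hzs
  exact hz (ne_of_gt hzs.2) hzs.1.1

/-- The derivative of a function vanishes almost everywhere on its zero set. -/
theorem ae_fderiv_apply_eq_zero_of_eq_zero {f : V → ℝ} (hf : Measurable f) (e : V) :
    ∀ᵐ x ∂μ, f x = 0 → DifferentiableAt ℝ f x → fderiv ℝ f x e = 0 := by
  have hA : MeasurableSet {x | f x = 0 ∧ DifferentiableAt ℝ f x ∧ fderiv ℝ f x e ≠ 0} :=
    (hf (measurableSet_singleton 0)).inter ((measurableSet_of_differentiableAt ℝ f).inter
      ((measurable_fderiv_apply_const ℝ f e) (measurableSet_singleton 0).compl))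
  have h0 := measure_eq_zero_of_countable_lines (μ := μ) e hA fun x =>
    (countable_setOf_eq_zero_of_hasDerivAt_ne_zero fun t => f (x + t • e)).mono fun t ht => by
      refine ⟨ht.1, _, ht.2.2, ?_⟩
      have hl : HasDerivAt (fun t : ℝ => x + t • e) e t := by
        simpa using ((hasDerivAt_id t).smul_const e).const_add x
      exact ht.2.1.hasFDerivAt.comp_hasDerivAt t hl
  filter_upwards [measure_eq_zero_iff_ae_notMem.1 h0] with x hx h1 h2
  by_contra h3
  exact hx ⟨h1, h2, h3⟩

/-- The bound on a segment in direction `e` uses only directional derivatives of orders `1` and `m +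
2`, which are bounded on a larger ball; so one constant serves all segments near the given ball, and
averaging applies. -/
theorem integrableOn_abs_fderiv_mul_rpow {v : V → ℝ} (hv : ContDiff ℝ ∞ v) (e : V) {α : ℝ}
    (hα : 0 < α) (hα1 : α < 1) (R : ℝ) :
    IntegrableOn (fun x => |fderiv ℝ v x e| * |v x| ^ (α - 1)) (Metric.closedBall 0 R) μ := by
  set g : ℕ → V → ℝ := fun k => (fun (w : V → ℝ) x => fderiv ℝ w x e)^[k] v with hg
  have hgc : ∀ k, ContDiff ℝ ∞ (g k) := contDiff_iterate_fderiv_apply hv e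
  have hgs : ∀ k x, fderiv ℝ (g k) x e = g (k + 1) x := fun k x => by
    simp only [hg, Function.iterate_succ_apply']
  obtain ⟨m, hm⟩ := exists_nat_ge (1 / α)
  have hmα : 1 ≤ (m + 2 : ℕ) * α := by
    rw [div_le_iff₀ hα] at hm
    push_cast
    nlinarith
  obtain ⟨M₁, hM₁⟩ := (isCompact_closedBall (0 : V) (R + 2 * ‖e‖)).exists_bound_of_continuousOn
    (hgc 1).continuous.continuousOn
  obtain ⟨M₂, hM₂⟩ := (isCompact_closedBall (0 : V) (R + 2 * ‖e‖)).exists_bound_of_continuousOn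
    (hgc (m + 2)).continuous.continuousOn
  set M := max M₁ M₂
  have hmeas : Measurable fun x => |fderiv ℝ v x e| * |v x| ^ (α - 1) := by
    have h1 : Measurable fun x => fderiv ℝ v x e := measurable_fderiv_apply_const ℝ v e
    have h2 : Measurable v := hv.continuous.measurable
    exact h1.abs.mul (h2.abs.pow_const _)
  set C : ENNReal := ENNReal.ofReal (2 ^ m * (2 / α * (M * 2 ^ (m + 1)) ^ α))
  have hline : ∀ x ∈ Metric.closedBall (0 : V) (R + ‖e‖), ∫⁻ t in Icc (0 : ℝ) 1,
      ENNReal.ofReal (|fderiv ℝ v (x + t • e) e| * |v (x + t • e)| ^ (α - 1)) ≤ C := by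
    intro x hx
    have hb : ∀ t ∈ Icc (0 : ℝ) 1, x + t • e ∈ Metric.closedBall (0 : V) (R + 2 * ‖e‖) := by
      intro t ht
      rw [mem_closedBall_zero_iff] at hx ⊢
      refine (norm_add_le _ _).trans ?_
      rw [norm_smul, Real.norm_of_nonneg ht.1]
      nlinarith [norm_nonneg e, ht.2]
    exact lintegral_abs_deriv_mul_rpow_le (f := fun k t => g k (x + t • e)) hα hα1 (fun k t => by
      have hl : HasDerivAt (fun t : ℝ => x + t • e) e t := by
        simpa using ((hasDerivAt_id t).smul_const e).const_add x
      rw [← hgs]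
      exact (((hgc k).differentiable (by simp)) _).hasFDerivAt.comp_hasDerivAt t hl) hmα
      (fun t ht => (hM₂ _ (hb t ht)).trans (le_max_right _ _))
      (fun t ht => (hM₁ _ (hb t ht)).trans (le_max_left _ _))
  refine ⟨hmeas.aestronglyMeasurable, ?_⟩
  rw [hasFiniteIntegral_iff_ofReal (Eventually.of_forall fun x => by positivity),
    ← lintegral_indicator Metric.isClosed_closedBall.measurableSet,
    lintegral_eq_lintegral_lintegral_add_smul e
      (hmeas.ennreal_ofReal.indicator Metric.isClosed_closedBall.measurableSet)]
  -- The segment from `x` can meet the ball only if `x` lies in the ball enlarged by `‖e‖`.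
  have hle : ∀ x, ∫⁻ t in Icc (0 : ℝ) 1, (Metric.closedBall (0 : V) R).indicator
      (fun x => ENNReal.ofReal (|fderiv ℝ v x e| * |v x| ^ (α - 1))) (x + t • e) ≤
      (Metric.closedBall (0 : V) (R + ‖e‖)).indicator (fun _ => C) x := by
    intro x
    by_cases hx : x ∈ Metric.closedBall (0 : V) (R + ‖e‖)
    · rw [indicator_of_mem hx]
      exact (lintegral_mono fun t => indicator_le_self _ _ _).trans (hline x hx)
    · rw [indicator_of_notMem hx, nonpos_iff_eq_zero]
      refine (setLIntegral_congr_fun measurableSet_Icc fun t ht => ?_).trans lintegral_zero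
      refine indicator_of_notMem (fun hmem => hx ?_) _
      rw [mem_closedBall_zero_iff] at hmem ⊢
      have h1 : ‖x‖ ≤ ‖x + t • e‖ + ‖t • e‖ := by
        simpa using norm_sub_le (x + t • e) (t • e)
      rw [norm_smul, Real.norm_of_nonneg ht.1] at h1
      nlinarith [norm_nonneg e, ht.2]
  refine (lintegral_mono hle).trans_lt ?_
  rw [lintegral_indicator Metric.isClosed_closedBall.measurableSet, setLIntegral_const]
  exact ENNReal.mul_lt_top ENNReal.ofReal_lt_top measure_closedBall_lt_top

end LineAverages

/-! ### The area formula for injective immersions. -/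

section AreaFormula

open Module

/-- `B ∘ A⁻¹` is `C`-Lipschitz on the image of `s`. Used in both directions to compare an immersion
with its derivative. -/
theorem euclideanHausdorffMeasure_image_le_of_edist_le {U X Y : Type*} [EMetricSpace X]
    [MeasurableSpace X] [BorelSpace X] [EMetricSpace Y] [MeasurableSpace Y] [BorelSpace Y]
    [Nonempty U] {A : U → X} {B : U → Y} (hA : Function.Injective A) {s : Set U} {C : NNReal}
    (h : ∀ y ∈ s, ∀ z ∈ s, edist (B y) (B z) ≤ C * edist (A y) (A z)) (d : ℕ) :
    Measure.euclideanHausdorffMeasure d (B '' s) ≤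
      (C : ENNReal) ^ d * Measure.euclideanHausdorffMeasure d (A '' s) := by
  have hinv : ∀ y, Function.invFun A (A y) = y := Function.leftInverse_invFun hA
  have hl : LipschitzOnWith C (B ∘ Function.invFun A) (A '' s) := by
    rintro _ ⟨y, hy, rfl⟩ _ ⟨z, hz, rfl⟩
    simpa only [Function.comp, hinv] using h y hy z hz
  have hB : (B ∘ Function.invFun A) '' (A '' s) = B '' s := by
    rw [image_image]
    simp only [Function.comp, hinv]
  have := hl.hausdorffMeasure_image_le (d := d) (Nat.cast_nonneg d)
  rw [hB, ENNReal.rpow_natCast] at this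
  simp only [Measure.euclideanHausdorffMeasure_def, Measure.smul_apply, ENNReal.smul_def,
    smul_eq_mul]
  rw [mul_left_comm]
  gcongr

/-- The Jacobian of a graph. -/
theorem normDet_graph {U V : Type*} [NormedAddCommGroup U] [InnerProductSpace ℝ U]
    [FiniteDimensional ℝ U] [NormedAddCommGroup V] [InnerProductSpace ℝ V] [FiniteDimensional ℝ V]
    (i : U →ₗᵢ[ℝ] V) {e : V} (he : ‖e‖ = 1)
    (hi : ∀ y, inner ℝ (i y) e = 0) (g : U) :
    (i.toLinearMap + (innerₗ U g).smulRight e).normDet = ‖e - i g‖ := by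
  rw [← sq_eq_sq₀ (LinearMap.normDet_nonneg _) (norm_nonneg _)]
  have h := LinearMap.normDet_sq (i.toLinearMap + (innerₗ U g).smulRight e)
  -- The Gram operator is the identity plus the rank-one map `v ↦ ⟨g, v⟩ g`, with determinant `1 +
  -- ‖g‖²`.
  have hadj : LinearMap.adjoint (i.toLinearMap + (innerₗ U g).smulRight e) ∘ₗ
      (i.toLinearMap + (innerₗ U g).smulRight e) = LinearMap.transvection (innerₗ U g) g := by
    ext v
    refine ext_inner_left ℝ fun w => ?_
    rw [LinearMap.comp_apply, LinearMap.adjoint_inner_right]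
    simp only [LinearMap.add_apply, LinearMap.smulRight_apply, inner_add_left, inner_add_right,
      LinearMap.transvection.apply, innerₗ_apply_apply, real_inner_smul_left, real_inner_smul_right,
      LinearIsometry.coe_toLinearMap, i.inner_map_map, hi, real_inner_self_eq_norm_sq, he,
      real_inner_comm (i _) e, real_inner_comm g w]
    ring
  rw [hadj, LinearMap.transvection.det] at h
  rw [innerₗ_apply_apply, real_inner_self_eq_norm_sq] at h
  rw [norm_sub_sq_real, he, i.norm_map, real_inner_comm, hi]
  simpa using h

variable {U V : Type*} [NormedAddCommGroup U] [InnerProductSpace ℝ U] [FiniteDimensional ℝ U]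
  [NormedAddCommGroup V] [InnerProductSpace ℝ V]

/-- Near each point an immersion distorts distances nearly like its derivative. -/
theorem exists_mem_nhds_edist_le_mul_edist {G : U → V} {L : U →L[ℝ] V} {x : U}
    (hG : HasStrictFDerivAt G L x) (hL : Function.Injective L) {C : NNReal} (hC : 1 < C) :
    ∃ t ∈ 𝓝 x, ∀ y ∈ t, ∀ z ∈ t, edist (G y) (G z) ≤ C * edist (L y) (L z) ∧
      edist (L y) (L z) ≤ C * edist (G y) (G z) := by
  obtain ⟨K, hK0, hK⟩ := (L : U →ₗ[ℝ] V).exists_antilipschitzWith (LinearMap.ker_eq_bot.2 hL)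
  have hC' : (1 : ℝ) < C := hC
  have hC0 : (0 : ℝ) < C := by linarith
  have hK0' : (0 : ℝ) < K := hK0
  -- Chosen so that the linearization error is at most `(1 - 1/C)‖L y - L z‖`. This gives both
  -- bounds, using `2 - 1/C ≤ C`.
  set c : ℝ := (1 - 1 / C) / K with hc
  have hc1 : 0 < 1 - 1 / (C : ℝ) := by
    rw [sub_pos, div_lt_one hC0]
    exact hC'
  have hc0 : 0 < c := by positivity
  obtain ⟨t, ht, hts⟩ := hG.approximates_deriv_on_nhds (c := ⟨c, hc0.le⟩) (Or.inr hc0)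
  refine ⟨t, ht, fun y hy z hz => ?_⟩
  have h1 : ‖G y - G z - L (y - z)‖ ≤ c * ‖y - z‖ := hts y hy z hz
  have h2 : ‖y - z‖ ≤ K * ‖L y - L z‖ := by
    have := hK.le_mul_dist y z
    rwa [dist_eq_norm, dist_eq_norm] at this
  have h3 : ‖G y - G z - (L y - L z)‖ ≤ (1 - 1 / C) * ‖L y - L z‖ := by
    rw [← map_sub] at h2 ⊢
    refine h1.trans ((mul_le_mul_of_nonneg_left h2 hc0.le).trans_eq ?_)
    rw [hc, ← mul_assoc, div_mul_cancel₀ _ hK0'.ne']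
  have h4 : ‖G y - G z‖ ≤ ‖G y - G z - (L y - L z)‖ + ‖L y - L z‖ := by
    simpa using norm_add_le (G y - G z - (L y - L z)) (L y - L z)
  have h5 : ‖L y - L z‖ ≤ ‖G y - G z‖ + ‖G y - G z - (L y - L z)‖ := by
    simpa using norm_sub_le (G y - G z) (G y - G z - (L y - L z))
  have hn := norm_nonneg (L y - L z)
  have key : ∀ a b : V, ∀ a' b' : V, ‖a - b‖ ≤ C * ‖a' - b'‖ → edist a b ≤ C * edist a' b' := by
    intro a b a' b' h
    rw [edist_dist, edist_dist, dist_eq_norm, dist_eq_norm, ← ENNReal.ofReal_coe_nnreal,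
      ← ENNReal.ofReal_mul hC0.le]
    exact ENNReal.ofReal_le_ofReal h
  constructor
  · refine key _ _ _ _ ?_
    have : 1 - 1 / (C : ℝ) + 1 ≤ C := by
      have : (C : ℝ) * (1 / C) = 1 := by field_simp
      nlinarith
    nlinarith
  · refine key _ _ _ _ ?_
    have h6 : 1 / (C : ℝ) * ‖L y - L z‖ ≤ ‖G y - G z‖ := by linarith
    calc ‖L y - L z‖ = C * (1 / C * ‖L y - L z‖) := by field_simp
      _ ≤ _ := by gcongr

variable [MeasurableSpace U] [BorelSpace U] [MeasurableSpace V] [BorelSpace V]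

/-- The area formula for an injective immersion. -/
theorem comap_euclideanHausdorffMeasure_eq_withDensity {G : U → V} (hG : ContDiff ℝ 1 G)
    (hinj : Function.Injective G) (himm : ∀ x, Function.Injective (fderiv ℝ G x)) :
    (Measure.euclideanHausdorffMeasure (finrank ℝ U)).comap G =
      volume.withDensity fun x => ENNReal.ofReal (fderiv ℝ G x : U →ₗ[ℝ] V).normDet := by
  have hemb : MeasurableEmbedding G := hG.continuous.measurableEmbedding hinj
  set d := finrank ℝ U
  set ρ : Measure U := (Measure.euclideanHausdorffMeasure d).comap G with hρ
  set N : U → ENNReal := fun x => ENNReal.ofReal (fderiv ℝ G x : U →ₗ[ℝ] V).normDet with hN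
  have hρa : ∀ s, ρ s = Measure.euclideanHausdorffMeasure d (G '' s) := fun s => hemb.comap_apply _ s
  have hLs : ∀ x s, Measure.euclideanHausdorffMeasure d (fderiv ℝ G x '' s) = N x * volume s :=
    fun x s => (fderiv ℝ G x : U →ₗ[ℝ] V).euclideanHausdorffMeasure_image_eq_normDet_mul_volume s
  -- Near `x` the pulled-back measure and `N x` times volume agree up to the factor `C^d`, for any
  -- prescribed `C > 1`. Taking `C = 2` gives absolute continuity and local finiteness; letting `C →
  -- 1` identifies the Besicovitch density with `N`.
  have hloc : ∀ x, ∀ C : NNReal, 1 < C → ∃ t ∈ 𝓝 x, ∀ s ⊆ t,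
      ρ s ≤ C ^ d * (N x * volume s) ∧ N x * volume s ≤ C ^ d * ρ s := by
    intro x C hC
    obtain ⟨t, ht, h⟩ := exists_mem_nhds_edist_le_mul_edist
      (hG.contDiffAt.hasStrictFDerivAt (by simp)) (himm x) hC
    refine ⟨t, ht, fun s hs => ?_⟩
    rw [hρa, ← hLs]
    exact ⟨euclideanHausdorffMeasure_image_le_of_edist_le (himm x)
      (fun y hy z hz => (h y (hs hy) z (hs hz)).1) d,
      euclideanHausdorffMeasure_image_le_of_edist_le hinj
      (fun y hy z hz => (h y (hs hy) z (hs hz)).2) d⟩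
  have hac : ρ ≪ volume := by
    intro s hs
    refine measure_null_of_locally_null s fun x _ => ?_
    obtain ⟨t, ht, h⟩ := hloc x 2 (by norm_num)
    refine ⟨t ∩ s, ?_, ?_⟩
    · rw [inter_comm]
      exact inter_mem_nhdsWithin s ht
    · have := (h (t ∩ s) inter_subset_left).1
      rw [measure_mono_null inter_subset_right hs] at this
      simpa using this
  have hfin : IsLocallyFiniteMeasure ρ := by
    refine ⟨fun x => ?_⟩
    obtain ⟨t, ht, h⟩ := hloc x 2 (by norm_num)
    obtain ⟨r, hr, hrt⟩ := Metric.nhds_basis_closedBall.mem_iff.1 ht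
    refine ⟨_, Metric.closedBall_mem_nhds x hr, (h _ hrt).1.trans_lt ?_⟩
    exact ENNReal.mul_lt_top (by simp) (ENNReal.mul_lt_top ENNReal.ofReal_lt_top
      measure_closedBall_lt_top)
  rw [← Measure.withDensity_rnDeriv_eq ρ volume hac]
  refine withDensity_congr_ae ?_
  filter_upwards [Besicovitch.ae_tendsto_rnDeriv ρ volume] with x hx
  have hev : ∀ C : NNReal, 1 < C → ρ.rnDeriv volume x ≤ C ^ d * N x ∧
      N x ≤ C ^ d * ρ.rnDeriv volume x := by
    intro C hC
    obtain ⟨t, ht, h⟩ := hloc x C hC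
    obtain ⟨r, hr, hrt⟩ := Metric.nhds_basis_closedBall.mem_iff.1 ht
    have hvol : ∀ r' > 0, volume (Metric.closedBall x r') ≠ 0 ∧
        volume (Metric.closedBall x r') ≠ ⊤ := fun r' hr' =>
      ⟨(Metric.measure_closedBall_pos volume x hr').ne', measure_closedBall_lt_top.ne⟩
    have hmem : Ioc 0 r ∈ 𝓝[>] (0 : ℝ) := Ioc_mem_nhdsGT hr
    constructor
    · refine le_of_tendsto hx ?_
      filter_upwards [hmem] with r' hr'
      rw [ENNReal.div_le_iff (hvol r' hr'.1).1 (hvol r' hr'.1).2, mul_assoc]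
      exact (h _ ((Metric.closedBall_subset_closedBall hr'.2).trans hrt)).1
    · refine ge_of_tendsto (ENNReal.Tendsto.const_mul hx (Or.inr (by simp))) ?_
      filter_upwards [hmem] with r' hr'
      rw [← mul_div_assoc, ENNReal.le_div_iff_mul_le (Or.inl (hvol r' hr'.1).1)
        (Or.inl (hvol r' hr'.1).2)]
      exact (h _ ((Metric.closedBall_subset_closedBall hr'.2).trans hrt)).2
  have hlim : ∀ a : ENNReal, Tendsto (fun C : NNReal => (C : ENNReal) ^ d * a) (𝓝[>] 1) (𝓝 a) := by
    intro a
    have h1 : Tendsto (fun C : NNReal => (C : ENNReal) ^ d) (𝓝[>] 1) (𝓝 1) := by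
      have : Tendsto (fun C : NNReal => (C : ENNReal)) (𝓝[>] 1) (𝓝 1) :=
        ENNReal.tendsto_coe.2 nhdsWithin_le_nhds
      simpa using ENNReal.Tendsto.pow (n := d) this
    simpa using ENNReal.Tendsto.mul_const (b := a) h1 (Or.inl one_ne_zero)
  have hself : ∀ᶠ C : NNReal in 𝓝[>] 1, 1 < C := self_mem_nhdsWithin
  exact le_antisymm (ge_of_tendsto (hlim _) (hself.mono fun C hC => (hev C hC).1))
    (ge_of_tendsto (hlim _) (hself.mono fun C hC => (hev C hC).2))

theorem map_withDensity_normDet_eq_restrict {G : U → V} (hG : ContDiff ℝ 1 G)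
    (hinj : Function.Injective G) (himm : ∀ x, Function.Injective (fderiv ℝ G x)) :
    (volume.withDensity fun x => ENNReal.ofReal (fderiv ℝ G x : U →ₗ[ℝ] V).normDet).map G =
      (Measure.euclideanHausdorffMeasure (finrank ℝ U)).restrict (range G) := by
  rw [← comap_euclideanHausdorffMeasure_eq_withDensity hG hinj himm,
    (hG.continuous.measurableEmbedding hinj).map_comap]

end AreaFormula

/-! ### The derivative of a smooth step as an approximate identity. -/

section SmoothStep

theorem deriv_smoothTransition_eq_zero {x : ℝ} (hx : x ∉ Icc (0 : ℝ) 1) :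
    deriv Real.smoothTransition x = 0 := by
  rw [mem_Icc, not_and_or, not_le, not_le] at hx
  rcases hx with hx | hx
  · have : Real.smoothTransition =ᶠ[𝓝 x] fun _ => 0 := by
      filter_upwards [gt_mem_nhds hx] with y hy
      exact Real.smoothTransition.zero_of_nonpos hy.le
    rw [this.deriv_eq, deriv_const]
  · have : Real.smoothTransition =ᶠ[𝓝 x] fun _ => 1 := by
      filter_upwards [lt_mem_nhds hx] with y hy
      exact Real.smoothTransition.one_of_one_le hy.le
    rw [this.deriv_eq, deriv_const]

theorem continuous_deriv_smoothTransition : Continuous (deriv Real.smoothTransition) :=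
  (Real.smoothTransition.contDiff (n := 1)).continuous_deriv le_rfl

theorem integrable_deriv_smoothTransition : Integrable (deriv Real.smoothTransition) :=
  continuous_deriv_smoothTransition.integrable_of_hasCompactSupport
    (HasCompactSupport.intro isCompact_Icc fun _ hx => deriv_smoothTransition_eq_zero hx)

theorem integral_deriv_smoothTransition : ∫ x, deriv Real.smoothTransition x = 1 := by
  have h1 : ∫ x in (0 : ℝ)..1, deriv Real.smoothTransition x = 1 := by
    rw [intervalIntegral.integral_deriv_eq_sub
      (fun x _ => (Real.smoothTransition.contDiff (n := 1)).differentiable (by simp) x)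
      (continuous_deriv_smoothTransition.intervalIntegrable _ _)]
    simp
  rw [← h1, intervalIntegral.integral_of_le zero_le_one, ← integral_Icc_eq_integral_Ioc,
    setIntegral_eq_integral_of_forall_compl_eq_zero fun x hx => deriv_smoothTransition_eq_zero hx]

end SmoothStep

/-! ### Integration over a line and its orthogonal complement. -/

section Splitting

variable {V : Type*} [NormedAddCommGroup V] [InnerProductSpace ℝ V] [FiniteDimensional ℝ V]
  [MeasurableSpace V] [BorelSpace V]

theorem measurePreserving_smul_add_orthogonal {e : V} (he : ‖e‖ = 1) :
    MeasurePreserving (fun q : ℝ × (ℝ ∙ e)ᗮ => q.1 • e + (q.2 : V)) := by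
  have h1 := (LinearIsometryEquiv.toSpanUnitSingleton (𝕜 := ℝ) e he).measurePreserving
  have h2 := h1.prod (MeasurePreserving.id (volume : Measure (ℝ ∙ e)ᗮ))
  have h3 := WithLp.volume_preserving_toLp (ℝ ∙ e) (ℝ ∙ e)ᗮ
  have h4 := (ℝ ∙ e).orthogonalDecomposition.symm.measurePreserving
  exact (h4.comp h3).comp h2

theorem measurableEmbedding_smul_add_orthogonal {e : V} (he : ‖e‖ = 1) :
    MeasurableEmbedding (fun q : ℝ × (ℝ ∙ e)ᗮ => q.1 • e + (q.2 : V)) := by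
  refine Continuous.measurableEmbedding (by fun_prop) fun q r h => ?_
  have key : ∀ q : ℝ × (ℝ ∙ e)ᗮ, inner ℝ e (q.1 • e + (q.2 : V)) = q.1 := fun q => by
    rw [inner_add_right, real_inner_smul_right, real_inner_self_eq_norm_sq, he,
      (Submodule.mem_orthogonal_singleton_iff_inner_right).1 q.2.2]
    norm_num
  have h1 : q.1 = r.1 := by
    rw [← key q, ← key r]
    exact congrArg _ h
  simp only [h1, add_right_inj] at h
  exact Prod.ext h1 (Subtype.ext h)

theorem norm_coe_le_norm_smul_add {V : Type*} [NormedAddCommGroup V] [InnerProductSpace ℝ V] {e : V} (t : ℝ) (y : (ℝ ∙ e)ᗮ) :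
    ‖y‖ ≤ ‖t • e + (y : V)‖ := by
  have h0 : inner ℝ (t • e) (y : V) = 0 := by
    rw [real_inner_smul_left, (Submodule.mem_orthogonal_singleton_iff_inner_right).1 y.2, mul_zero]
  have := norm_add_sq_eq_norm_sq_add_norm_sq_of_inner_eq_zero _ _ h0
  rw [Submodule.coe_norm]
  nlinarith [norm_nonneg (t • e + (y : V)), norm_nonneg (y : V), norm_nonneg (t • e)]

/-- Averages over thinner and thinner layers below a graph converge to the integral over the
graph (with respect to the measure of the base). -/
theorem tendsto_integral_layer {e : V} (he : ‖e‖ = 1) {γ : V → ℝ} (hγ : Continuous γ)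
    (hγe : ∀ y (t : ℝ), γ (y + t • e) = γ y) {q : V → ℝ} (hq : Continuous q)
    (hqc : HasCompactSupport q) :
    Tendsto (fun k : ℕ => ∫ x, ((k : ℝ) + 1) *
      deriv Real.smoothTransition (-(((k : ℝ) + 1) * (inner ℝ x e - γ x))) * q x) atTop
      (𝓝 (∫ y : (ℝ ∙ e)ᗮ, q (γ y • e + (y : V)))) := by
  have hT := continuous_deriv_smoothTransition
  have hTi := integrable_deriv_smoothTransition
  set T := deriv Real.smoothTransition
  obtain ⟨C, hC⟩ := hq.bounded_above_of_compact_support hqc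
  have hC0 : 0 ≤ C := (norm_nonneg _).trans (hC 0)
  obtain ⟨R, hR⟩ := hqc.isCompact.isBounded.subset_closedBall 0
  have hq0 : ∀ t : ℝ, ∀ y : (ℝ ∙ e)ᗮ, R < ‖y‖ → q (t • e + (y : V)) = 0 := by
    intro t y hy
    by_contra h
    have := hR (subset_tsupport _ h)
    rw [mem_closedBall_zero_iff] at this
    linarith [norm_coe_le_norm_smul_add (e := e) t y]
  have hsplit : ∀ k : ℕ, ∫ x, ((k : ℝ) + 1) * T (-(((k : ℝ) + 1) * (inner ℝ x e - γ x))) * q x =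
      ∫ y : (ℝ ∙ e)ᗮ, ∫ t : ℝ, T t * q ((γ y - t / ((k : ℝ) + 1)) • e + (y : V)) := by
    intro k
    have hk : (0 : ℝ) < (k : ℝ) + 1 := by positivity
    set H : V → ℝ := fun x => ((k : ℝ) + 1) * T (-(((k : ℝ) + 1) * (inner ℝ x e - γ x))) * q x
      with hH
    have hHc : Continuous H := by
      have : Continuous fun x => T (-(((k : ℝ) + 1) * (inner ℝ x e - γ x))) :=
        hT.comp (by fun_prop)
      fun_prop
    have hHi : Integrable H := hHc.integrable_of_hasCompactSupport hqc.mul_left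
    have hmp := measurePreserving_smul_add_orthogonal he
    have hme := measurableEmbedding_smul_add_orthogonal he
    rw [← hmp.integral_comp hme H]
    have hHi' : Integrable (fun z : ℝ × (ℝ ∙ e)ᗮ => H (z.1 • e + (z.2 : V))) :=
      (hmp.integrable_comp_emb hme).2 hHi
    rw [Measure.volume_eq_prod] at hHi' ⊢
    rw [integral_prod_symm _ hHi']
    refine integral_congr_ae (Eventually.of_forall fun y => ?_)
    have hinner : ∀ t : ℝ, inner ℝ (t • e + (y : V)) e = t := fun t => by
      rw [inner_add_left, real_inner_smul_left, real_inner_self_eq_norm_sq, he,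
        (Submodule.mem_orthogonal_singleton_iff_inner_left).1 y.2]
      norm_num
    have hgam : ∀ t : ℝ, γ (t • e + (y : V)) = γ y := fun t => by rw [add_comm, hγe]
    -- Rescaled variable `t = (k+1)(γ - r)`, where `r` is the height along `e`: the factor `k + 1`
    -- cancels and the layer becomes the fixed interval supporting `T`.
    set F : ℝ → ℝ := fun t => T t * q ((γ y - t / ((k : ℝ) + 1)) • e + (y : V)) with hF
    have h1 := integral_sub_left_eq_self (fun r => F (((k : ℝ) + 1) * r)) volume (γ y)
    rw [Measure.integral_comp_mul_left, abs_of_pos (by positivity), smul_eq_mul] at h1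
    have h2 : ∀ t : ℝ, H (t • e + (y : V)) = ((k : ℝ) + 1) * F (((k : ℝ) + 1) * (γ y - t)) := by
      intro t
      simp only [hH, hF, hinner, hgam]
      rw [mul_div_cancel_left₀ _ hk.ne', sub_sub_cancel, mul_assoc,
        show -(((k : ℝ) + 1) * (t - γ y)) = ((k : ℝ) + 1) * (γ y - t) by ring]
    simp only [h2]
    rw [integral_const_mul, h1, mul_inv_cancel_left₀ hk.ne']
  simp only [hsplit]
  have hlim0 : Tendsto (fun k : ℕ => 1 / ((k : ℝ) + 1)) atTop (𝓝 0) :=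
    tendsto_one_div_add_atTop_nhds_zero_nat
  refine tendsto_integral_of_dominated_convergence
    (fun y => (Metric.closedBall (0 : (ℝ ∙ e)ᗮ) R).indicator (fun _ => ∫ t, ‖T t‖ * C) y)
    (fun k => ?_) ?_ (fun k => Eventually.of_forall fun y => ?_) (Eventually.of_forall fun y => ?_)
  · have : Continuous (Function.uncurry fun (y : (ℝ ∙ e)ᗮ) (t : ℝ) =>
        T t * q ((γ y - t / ((k : ℝ) + 1)) • e + (y : V))) := by
      simp only [Function.uncurry_def]
      fun_prop
    exact this.stronglyMeasurable.integral_prod_right.aestronglyMeasurable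
  · exact (integrable_indicator_iff Metric.isClosed_closedBall.measurableSet).2
      (integrableOn_const measure_closedBall_lt_top.ne)
  · by_cases hy : y ∈ Metric.closedBall (0 : (ℝ ∙ e)ᗮ) R
    · rw [indicator_of_mem hy]
      refine norm_integral_le_of_norm_le (hTi.norm.mul_const C) (Eventually.of_forall fun t => ?_)
      rw [norm_mul]
      exact mul_le_mul_of_nonneg_left (hC _) (norm_nonneg _)
    · rw [indicator_of_notMem hy]
      rw [mem_closedBall_zero_iff, not_le] at hy
      simp [hq0 _ y hy]
  · have h1 : ∫ t, T t * q (γ y • e + (y : V)) = q (γ y • e + (y : V)) := by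
      rw [integral_mul_const, integral_deriv_smoothTransition, one_mul]
    rw [← h1]
    refine tendsto_integral_of_dominated_convergence (fun t => ‖T t‖ * C) (fun k => ?_)
      (hTi.norm.mul_const C) (fun k => Eventually.of_forall fun t => ?_)
      (Eventually.of_forall fun t => ?_)
    · have : Continuous fun t => T t * q ((γ y - t / ((k : ℝ) + 1)) • e + (y : V)) := by fun_prop
      exact this.aestronglyMeasurable
    · rw [norm_mul]
      exact mul_le_mul_of_nonneg_left (hC _) (norm_nonneg _)
    · refine Tendsto.const_mul _ ((hq.tendsto _).comp ?_)
      have h2 : Tendsto (fun k : ℕ => γ y - t / ((k : ℝ) + 1)) atTop (𝓝 (γ y)) := by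
        have := (hlim0.const_mul t).const_sub (γ y)
        simpa only [mul_zero, sub_zero, mul_one_div] using this
      exact (h2.smul_const e).add_const _

end Splitting

/-! ### The divergence theorem below a graph, in graph coordinates. -/

section DivergenceOverGraph

theorem inner_gradient_eq_fderiv {V : Type*} [NormedAddCommGroup V] [InnerProductSpace ℝ V]
    [CompleteSpace V] (f : V → ℝ) (x v : V) : inner ℝ (gradient f x) v = fderiv ℝ f x v := by
  rw [gradient, InnerProductSpace.toDual_symm_apply]

theorem continuous_gradient {V : Type*} [NormedAddCommGroup V] [InnerProductSpace ℝ V]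
    [CompleteSpace V] {f : V → ℝ} (hf : ContDiff ℝ 1 f) : Continuous (gradient f) :=
  (InnerProductSpace.toDual ℝ V).symm.continuous.comp (hf.continuous_fderiv (by simp))

variable {n : ℕ}

theorem euclidean_sum_smul_single (v : EuclideanSpace ℝ (Fin n)) :
    ∑ i, v i • EuclideanSpace.single i (1 : ℝ) = v := by
  simpa using (EuclideanSpace.basisFun (Fin n) ℝ).sum_repr v

theorem fderiv_coord_apply {G : EuclideanSpace ℝ (Fin n) → EuclideanSpace ℝ (Fin n)}
    {x : EuclideanSpace ℝ (Fin n)} (hG : DifferentiableAt ℝ G x) (i : Fin n)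
    (v : EuclideanSpace ℝ (Fin n)) :
    fderiv ℝ (fun y => G y i) x v = fderiv ℝ G x v i := by
  have h := (EuclideanSpace.proj (𝕜 := ℝ) i).hasFDerivAt.comp x hG.hasFDerivAt
  have h' : fderiv ℝ (fun y => G y i) x = (EuclideanSpace.proj i).comp (fderiv ℝ G x) := h.fderiv
  rw [h']
  rfl

theorem continuous_divergence {G : EuclideanSpace ℝ (Fin n) → EuclideanSpace ℝ (Fin n)}
    (hG : ContDiff ℝ 1 G) : Continuous (divergence G) := by
  refine continuous_finsetSum _ fun i _ => ?_
  have h1 : Continuous fun x => fderiv ℝ G x (EuclideanSpace.single i 1) :=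
    (hG.continuous_fderiv (by simp)).clm_apply continuous_const
  exact (EuclideanSpace.proj (𝕜 := ℝ) i).continuous.comp h1

theorem divergence_eq_zero_of_notMem_tsupport
    {G : EuclideanSpace ℝ (Fin n) → EuclideanSpace ℝ (Fin n)} {x : EuclideanSpace ℝ (Fin n)}
    (hx : x ∉ tsupport G) : divergence G x = 0 := by
  have h : fderiv ℝ G x = 0 := by
    by_contra h
    exact hx (support_fderiv_subset ℝ h)
  simp [divergence, h]

theorem hasCompactSupport_divergence {G : EuclideanSpace ℝ (Fin n) → EuclideanSpace ℝ (Fin n)}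
    (hG : HasCompactSupport G) : HasCompactSupport (divergence G) :=
  HasCompactSupport.intro hG fun _ hx => divergence_eq_zero_of_notMem_tsupport hx

theorem integral_mul_divergence {h : EuclideanSpace ℝ (Fin n) → ℝ}
    {G : EuclideanSpace ℝ (Fin n) → EuclideanSpace ℝ (Fin n)} (hh : ContDiff ℝ 1 h)
    (hG : ContDiff ℝ 1 G) (hGc : HasCompactSupport G) :
    ∫ x, h x * divergence G x = -∫ x, fderiv ℝ h x (G x) := by
  have hGi : ∀ i, ContDiff ℝ 1 fun x => G x i := fun i =>
    (EuclideanSpace.proj (𝕜 := ℝ) i).contDiff.comp hG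
  have hGci : ∀ i, HasCompactSupport fun x => G x i := fun i =>
    hGc.comp_left (g := fun v : EuclideanSpace ℝ (Fin n) => v i) rfl
  have c1 : ∀ i, Continuous fun x => fderiv ℝ h x (EuclideanSpace.single i 1) := fun i =>
    (hh.continuous_fderiv (by simp)).clm_apply continuous_const
  have c2 : ∀ i, Continuous fun x => fderiv ℝ (fun y => G y i) x (EuclideanSpace.single i 1) :=
    fun i => ((hGi i).continuous_fderiv (by simp)).clm_apply continuous_const
  have s2 : ∀ i, HasCompactSupport fun x =>
      fderiv ℝ (fun y => G y i) x (EuclideanSpace.single i 1) := fun i =>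
    (hGci i).fderiv_apply ℝ _
  have i1 : ∀ i, Integrable fun x => fderiv ℝ h x (EuclideanSpace.single i 1) * G x i := fun i =>
    ((c1 i).mul (hGi i).continuous).integrable_of_hasCompactSupport (hGci i).mul_left
  have i2 : ∀ i, Integrable fun x =>
      h x * fderiv ℝ (fun y => G y i) x (EuclideanSpace.single i 1) := fun i =>
    (hh.continuous.mul (c2 i)).integrable_of_hasCompactSupport (s2 i).mul_left
  have i3 : ∀ i, Integrable fun x => h x * G x i := fun i =>
    (hh.continuous.mul (hGi i).continuous).integrable_of_hasCompactSupport (hGci i).mul_left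
  have e1 : ∀ x, h x * divergence G x =
      ∑ i, h x * fderiv ℝ (fun y => G y i) x (EuclideanSpace.single i 1) := fun x => by
    rw [divergence, Finset.mul_sum]
    exact Finset.sum_congr rfl fun i _ => by
      rw [fderiv_coord_apply (hG.differentiable (by simp) x)]
  have e2 : ∀ x, fderiv ℝ h x (G x) =
      ∑ i, fderiv ℝ h x (EuclideanSpace.single i 1) * G x i := fun x => by
    conv_lhs => rw [← euclidean_sum_smul_single (G x), map_sum]
    exact Finset.sum_congr rfl fun i _ => by rw [map_smul, smul_eq_mul, mul_comm]
  simp only [e1, e2]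
  rw [integral_finsetSum _ fun i _ => i2 i, integral_finsetSum _ fun i _ => i1 i,
    ← Finset.sum_neg_distrib]
  exact Finset.sum_congr rfl fun i _ => integral_mul_fderiv_eq_neg_fderiv_mul_of_integrable
    (i1 i) (i2 i) (i3 i) (fun x _ => hh.differentiable (by simp) x)
    (fun x _ => (hGi i).differentiable (by simp) x)

/-- The cutoffs `θ k` converge to the indicator of the subgraph. After integration by parts their
gradients concentrate in a layer of height `1/(k+1)` below the graph and point along `-(e - ∇γ)`.
The normal appears unnormalized because the integral is over the base. -/
theorem setIntegral_divergence_subgraph {e : EuclideanSpace ℝ (Fin n)} (he : ‖e‖ = 1)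
    {γ : EuclideanSpace ℝ (Fin n) → ℝ} (hγ : ContDiff ℝ 1 γ)
    (hγe : ∀ y (t : ℝ), γ (y + t • e) = γ y)
    {G : EuclideanSpace ℝ (Fin n) → EuclideanSpace ℝ (Fin n)}
    (hG : ContDiff ℝ 1 G) (hGc : HasCompactSupport G) :
    ∫ x in {x | inner ℝ x e < γ x}, divergence G x =
      ∫ y : (ℝ ∙ e)ᗮ, inner ℝ (e - gradient γ (γ y • e + (y : EuclideanSpace ℝ (Fin n))))
        (G (γ y • e + (y : EuclideanSpace ℝ (Fin n)))) := by
  set w : EuclideanSpace ℝ (Fin n) → ℝ := fun x => inner ℝ x e - γ x with hw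
  have hwc : ContDiff ℝ 1 w := (contDiff_id.inner ℝ contDiff_const).sub hγ
  have hwd : ∀ x v, fderiv ℝ w x v = inner ℝ (e - gradient γ x) v := by
    intro x v
    have h1 : HasFDerivAt (fun x => inner ℝ x e) (innerSL ℝ e) x := by
      have := (innerSL ℝ e).hasFDerivAt (x := x)
      refine this.congr_of_eventuallyEq (Eventually.of_forall fun y => ?_)
      simp [real_inner_comm]
    have h2 := h1.sub (hγ.differentiable (by simp) x).hasFDerivAt
    have h3 : fderiv ℝ w x = innerSL ℝ e - fderiv ℝ γ x := h2.fderiv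
    rw [h3, inner_sub_left, inner_gradient_eq_fderiv]
    rfl
  set q : EuclideanSpace ℝ (Fin n) → ℝ := fun x => inner ℝ (e - gradient γ x) (G x) with hq
  have hqc : Continuous q :=
    (continuous_const.sub (continuous_gradient hγ)).inner hG.continuous
  have hqs : HasCompactSupport q := HasCompactSupport.intro hGc fun x hx => by
    simp [hq, image_eq_zero_of_notMem_tsupport hx]
  set θ : ℕ → EuclideanSpace ℝ (Fin n) → ℝ := fun k x =>
    Real.smoothTransition (-(((k : ℝ) + 1) * w x)) with hθ
  have hθc : ∀ k, ContDiff ℝ 1 (θ k) := fun k =>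
    Real.smoothTransition.contDiff.comp ((contDiff_const.mul hwc).neg)
  have hθd : ∀ k x, fderiv ℝ (θ k) x (G x) =
      -(((k : ℝ) + 1) * deriv Real.smoothTransition (-(((k : ℝ) + 1) * w x)) * q x) := by
    intro k x
    have h1 := ((hwc.differentiable (by simp) x).hasFDerivAt.const_mul ((k : ℝ) + 1)).neg
    have h2 := (Real.smoothTransition.contDiff (n := 1)).differentiable (by simp)
      (-(((k : ℝ) + 1) * w x))
    have h3 := h2.hasDerivAt.comp_hasFDerivAt x h1
    have h4 : fderiv ℝ (θ k) x = _ := h3.fderiv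
    rw [h4]
    simp only [smul_apply, neg_apply, hwd, smul_eq_mul, hq]
    ring
  have hlim := tendsto_integral_layer he hγ.continuous hγe hqc hqs
  refine tendsto_nhds_unique (f := fun k : ℕ => ∫ x, θ k x * divergence G x) (l := atTop) ?_ ?_
  · have hmeas : MeasurableSet {x : EuclideanSpace ℝ (Fin n) | inner ℝ x e < γ x} :=
      (isOpen_lt (by fun_prop) hγ.continuous).measurableSet
    rw [← integral_indicator hmeas]
    have hdi := (continuous_divergence hG).integrable_of_hasCompactSupport
      (hasCompactSupport_divergence hGc) (μ := volume)
    refine tendsto_integral_of_dominated_convergence (fun x => ‖divergence G x‖)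
      (fun k => ((hθc k).continuous.mul (continuous_divergence hG)).aestronglyMeasurable)
      hdi.norm (fun k => Eventually.of_forall fun x => ?_) (Eventually.of_forall fun x => ?_)
    · rw [norm_mul]
      refine mul_le_of_le_one_left (norm_nonneg _) ?_
      rw [Real.norm_of_nonneg (Real.smoothTransition.nonneg _)]
      exact Real.smoothTransition.le_one _
    · by_cases hx : inner ℝ x e < γ x
      · rw [indicator_of_mem (by exact hx)]
        have hwx : w x < 0 := sub_neg.2 hx
        obtain ⟨K, hK⟩ := exists_nat_ge (1 / -w x)
        refine tendsto_const_nhds.congr' ?_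
        filter_upwards [eventually_ge_atTop K] with k hk
        have : 1 ≤ -(((k : ℝ) + 1) * w x) := by
          rw [div_le_iff₀ (by linarith)] at hK
          have : (K : ℝ) ≤ k := by exact_mod_cast hk
          nlinarith
        rw [hθ]
        simp only [Real.smoothTransition.one_of_one_le this, one_mul]
      · rw [indicator_of_notMem (by exact hx)]
        have hwx : 0 ≤ w x := sub_nonneg.2 (not_lt.1 hx)
        have h0 : ∀ k : ℕ, θ k x * divergence G x = 0 := fun k => by
          have : -(((k : ℝ) + 1) * w x) ≤ 0 := by
            have : 0 ≤ ((k : ℝ) + 1) * w x := by positivity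
            linarith
          simp only [hθ, Real.smoothTransition.zero_of_nonpos this, zero_mul]
        simp only [h0]
        exact tendsto_const_nhds
  · simp only [integral_mul_divergence (hθc _) hG hGc, hθd, integral_neg, neg_neg]
    exact hlim

end DivergenceOverGraph

/-! ### Hausdorff measure on a graph. -/

section SurfaceMeasureOfGraph

open Module

variable {n : ℕ} {e : EuclideanSpace ℝ (Fin n)} {γ : EuclideanSpace ℝ (Fin n) → ℝ}

/-- The parametrization of a graph over the hyperplane orthogonal to `e`. -/
def graphParam (e : EuclideanSpace ℝ (Fin n)) (γ : EuclideanSpace ℝ (Fin n) → ℝ)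
    (y : (ℝ ∙ e)ᗮ) : EuclideanSpace ℝ (Fin n) :=
  γ y • e + (y : EuclideanSpace ℝ (Fin n))

theorem inner_smul_add_orthogonal (he : ‖e‖ = 1) (t : ℝ) (y : (ℝ ∙ e)ᗮ) :
    inner ℝ (t • e + (y : EuclideanSpace ℝ (Fin n))) e = t := by
  rw [inner_add_left, real_inner_smul_left, real_inner_self_eq_norm_sq, he,
    (Submodule.mem_orthogonal_singleton_iff_inner_left).1 y.2]
  norm_num

theorem contDiff_graphParam (hγ : ContDiff ℝ 1 γ) : ContDiff ℝ 1 (graphParam e γ) := by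
  have h : ContDiff ℝ 1 fun y : (ℝ ∙ e)ᗮ => (y : EuclideanSpace ℝ (Fin n)) :=
    (ℝ ∙ e)ᗮ.subtypeL.contDiff
  exact ((hγ.comp h).smul contDiff_const).add h

theorem graphParam_injective (he : ‖e‖ = 1) : Function.Injective (graphParam e γ) := by
  intro y z h
  have h1 := inner_smul_add_orthogonal he (γ y) y
  have h2 := inner_smul_add_orthogonal he (γ z) z
  simp only [graphParam] at h
  rw [h, h2] at h1
  rw [h1, add_right_inj] at h
  exact Subtype.ext h

theorem range_graphParam (he : ‖e‖ = 1) (hγe : ∀ y (t : ℝ), γ (y + t • e) = γ y) :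
    range (graphParam e γ) = {x | inner ℝ x e = γ x} := by
  ext x
  simp only [mem_range, mem_ofPred_eq]
  constructor
  · rintro ⟨y, rfl⟩
    rw [graphParam, inner_smul_add_orthogonal he, add_comm, hγe]
  · intro hx
    have hmem : x - γ x • e ∈ (ℝ ∙ e)ᗮ := by
      rw [Submodule.mem_orthogonal_singleton_iff_inner_left, inner_sub_left, real_inner_smul_left,
        real_inner_self_eq_norm_sq, he, hx]
      norm_num
    refine ⟨⟨x - γ x • e, hmem⟩, ?_⟩
    have : γ (x - γ x • e) = γ x := by
      rw [sub_eq_add_neg, ← neg_smul, hγe]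
    simp only [graphParam, this, add_sub_cancel]

theorem gradient_add_smul (hγe : ∀ y (t : ℝ), γ (y + t • e) = γ y)
    (x : EuclideanSpace ℝ (Fin n)) (t : ℝ) : gradient γ (x + t • e) = gradient γ x := by
  have h := fderiv_comp_add_right (𝕜 := ℝ) (f := γ) (x := x) (t • e)
  simp only [hγe] at h
  rw [gradient, gradient, h]

theorem gradient_mem_orthogonal (hγ : ContDiff ℝ 1 γ) (hγe : ∀ y (t : ℝ), γ (y + t • e) = γ y)
    (x : EuclideanSpace ℝ (Fin n)) : gradient γ x ∈ (ℝ ∙ e)ᗮ := by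
  rw [Submodule.mem_orthogonal_singleton_iff_inner_left, inner_gradient_eq_fderiv]
  have hl : HasDerivAt (fun t : ℝ => x + t • e) e 0 := by
    simpa using ((hasDerivAt_id (0 : ℝ)).smul_const e).const_add x
  have hd : HasFDerivAt γ (fderiv ℝ γ x) (x + (0 : ℝ) • e) := by
    simpa using (hγ.differentiable (by simp) x).hasFDerivAt
  have h1 := hd.comp_hasDerivAt (0 : ℝ) hl
  have h2 : (γ ∘ fun t : ℝ => x + t • e) = fun _ => γ x := funext fun t => hγe x t
  rw [h2] at h1
  exact h1.unique (hasDerivAt_const _ _)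

theorem fderiv_graphParam (hγ : ContDiff ℝ 1 γ) (hγe : ∀ y (t : ℝ), γ (y + t • e) = γ y)
    (y : (ℝ ∙ e)ᗮ) :
    (fderiv ℝ (graphParam e γ) y : (ℝ ∙ e)ᗮ →ₗ[ℝ] EuclideanSpace ℝ (Fin n)) =
      (ℝ ∙ e)ᗮ.subtypeₗᵢ.toLinearMap +
        (innerₗ (ℝ ∙ e)ᗮ ⟨gradient γ y, gradient_mem_orthogonal hγ hγe y⟩).smulRight e := by
  have hs := (ℝ ∙ e)ᗮ.subtypeL.hasFDerivAt (x := y)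
  have hg := (hγ.differentiable (by simp) (y : EuclideanSpace ℝ (Fin n))).hasFDerivAt.comp y hs
  have h := (hg.smul_const e).add hs
  have h' : fderiv ℝ (graphParam e γ) y = _ := h.fderiv
  rw [h']
  ext v : 1
  simp only [ContinuousLinearMap.coe_coe, add_apply,
    ContinuousLinearMap.smulRight_apply, ContinuousLinearMap.comp_apply, LinearMap.add_apply,
    LinearMap.smulRight_apply, innerₗ_apply_apply, Submodule.coe_inner, inner_gradient_eq_fderiv,
    Submodule.subtypeL_apply]
  exact add_comm _ _

theorem normDet_fderiv_graphParam (he : ‖e‖ = 1) (hγ : ContDiff ℝ 1 γ)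
    (hγe : ∀ y (t : ℝ), γ (y + t • e) = γ y) (y : (ℝ ∙ e)ᗮ) :
    (fderiv ℝ (graphParam e γ) y : (ℝ ∙ e)ᗮ →ₗ[ℝ] EuclideanSpace ℝ (Fin n)).normDet =
      ‖e - gradient γ (graphParam e γ y)‖ := by
  rw [fderiv_graphParam hγ hγe, normDet_graph _ he fun v =>
    (Submodule.mem_orthogonal_singleton_iff_inner_left).1 v.2, graphParam, add_comm,
    gradient_add_smul hγe]
  rfl

theorem fderiv_graphParam_injective (he : ‖e‖ = 1) (hγ : ContDiff ℝ 1 γ)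
    (hγe : ∀ y (t : ℝ), γ (y + t • e) = γ y) (y : (ℝ ∙ e)ᗮ) :
    Function.Injective (fderiv ℝ (graphParam e γ) y) := by
  have h : ∀ v, fderiv ℝ (graphParam e γ) y v = inner ℝ (gradient γ y) (v : EuclideanSpace ℝ (Fin n))
      • e + (v : EuclideanSpace ℝ (Fin n)) := fun v => by
    have := LinearMap.congr_fun (fderiv_graphParam hγ hγe y) v
    rw [add_comm]
    exact this
  intro v v' hv
  rw [h, h] at hv
  have h1 := inner_smul_add_orthogonal he (inner ℝ (gradient γ y) (v : EuclideanSpace ℝ (Fin n))) v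
  rw [hv, inner_smul_add_orthogonal he] at h1
  rw [h1, add_right_inj] at hv
  exact Subtype.ext hv

theorem finrank_orthogonal_span_unit (he : ‖e‖ = 1) : finrank ℝ (ℝ ∙ e)ᗮ = n - 1 := by
  have h := (ℝ ∙ e).finrank_add_finrank_orthogonal
  have h1 : finrank ℝ (ℝ ∙ e) = 1 := finrank_span_singleton fun h => by simp [h] at he
  rw [h1, finrank_euclideanSpace_fin] at h
  omega

/-- By the area formula, surface measure has density `‖e - ∇γ‖` in graph coordinates, which is
exactly the length lost when the normal is normalized. -/
theorem map_graphParam (he : ‖e‖ = 1) (hγ : ContDiff ℝ 1 γ)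
    (hγe : ∀ y (t : ℝ), γ (y + t • e) = γ y) :
    (volume.withDensity fun y => ENNReal.ofReal ‖e - gradient γ (graphParam e γ y)‖).map
      (graphParam e γ) =
      (Measure.euclideanHausdorffMeasure (n - 1)).restrict {x | inner ℝ x e = γ x} := by
  have h := map_withDensity_normDet_eq_restrict (contDiff_graphParam hγ) (graphParam_injective he)
    (fderiv_graphParam_injective he hγ hγe)
  simp only [normDet_fderiv_graphParam he hγ hγe] at h
  rw [h, finrank_orthogonal_span_unit he, range_graphParam he hγe]

theorem continuous_norm_sub_gradient_graphParam (hγ : ContDiff ℝ 1 γ) :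
    Continuous fun y => ‖e - gradient γ (graphParam e γ y)‖ :=
  (continuous_const.sub ((continuous_gradient hγ).comp (contDiff_graphParam hγ).continuous)).norm

theorem setIntegral_graph (he : ‖e‖ = 1) (hγ : ContDiff ℝ 1 γ)
    (hγe : ∀ y (t : ℝ), γ (y + t • e) = γ y) (f : EuclideanSpace ℝ (Fin n) → ℝ) :
    ∫ x in {x | inner ℝ x e = γ x}, f x ∂(Measure.euclideanHausdorffMeasure (n - 1)) =
      ∫ y, ‖e - gradient γ (graphParam e γ y)‖ * f (graphParam e γ y) := by
  have hemb := (contDiff_graphParam hγ).continuous.measurableEmbedding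
    (graphParam_injective (γ := γ) he)
  rw [← map_graphParam he hγ hγe, hemb.integral_map, integral_withDensity_eq_integral_toReal_smul
    (continuous_norm_sub_gradient_graphParam hγ).measurable.ennreal_ofReal
    (Eventually.of_forall fun _ => ENNReal.ofReal_lt_top)]
  simp only [ENNReal.toReal_ofReal (norm_nonneg _), smul_eq_mul]

theorem measure_graph_inter_ball_lt_top (he : ‖e‖ = 1) (hγ : ContDiff ℝ 1 γ)
    (hγe : ∀ y (t : ℝ), γ (y + t • e) = γ y) (R : ℝ) :
    (Measure.euclideanHausdorffMeasure (n - 1)).restrict {x | inner ℝ x e = γ x}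
      (Metric.closedBall (0 : EuclideanSpace ℝ (Fin n)) R) < ⊤ := by
  have hemb := (contDiff_graphParam hγ).continuous.measurableEmbedding
    (graphParam_injective (γ := γ) he)
  rw [← map_graphParam he hγ hγe, hemb.map_apply, withDensity_apply _
    (hemb.measurable Metric.isClosed_closedBall.measurableSet)]
  have hsub : graphParam e γ ⁻¹' Metric.closedBall 0 R ⊆ Metric.closedBall 0 R := fun y hy => by
    rw [mem_preimage, mem_closedBall_zero_iff] at hy
    rw [mem_closedBall_zero_iff]
    exact (norm_coe_le_norm_smul_add _ y).trans hy
  refine (lintegral_mono_set hsub).trans_lt ?_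
  have hc := (continuous_norm_sub_gradient_graphParam (e := e) hγ).continuousOn.integrableOn_compact
    (μ := volume) (isCompact_closedBall (0 : (ℝ ∙ e)ᗮ) R)
  have := hc.2
  rwa [hasFiniteIntegral_iff_ofReal (Eventually.of_forall fun _ => norm_nonneg _)] at this

end SurfaceMeasureOfGraph

/-! ### The divergence theorem on smooth bounded domains. -/

section DivergenceTheorem

open scoped Manifold

variable {n : ℕ} {Ω : Set (EuclideanSpace ℝ (Fin n))}

theorem norm_exteriorUnitNormal_le (x : EuclideanSpace ℝ (Fin n)) :
    ‖exteriorUnitNormal Ω x‖ ≤ 1 := by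
  rw [exteriorUnitNormal]
  split_ifs with h
  · obtain ⟨e, γ, -, hν⟩ := h.choose_spec
    rw [hν, norm_smul, norm_inv, norm_norm]
    exact inv_mul_le_one
  · simp

theorem exteriorUnitNormal_eq {x e : EuclideanSpace ℝ (Fin n)} {γ : EuclideanSpace ℝ (Fin n) → ℝ}
    (hΩ : IsOpen Ω) (hx : x ∈ frontier Ω) (h : IsBoundaryGraphAt Ω x e γ) :
    exteriorUnitNormal Ω x = ‖e - gradient γ x‖⁻¹ • (e - gradient γ x) := by
  have hex : ∃ ν, IsExteriorUnitNormalAt Ω x ν := ⟨_, e, γ, h, rfl⟩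
  rw [exteriorUnitNormal, dif_pos hex]
  exact hex.choose_spec.unique hx hΩ ⟨e, γ, h, rfl⟩

theorem mem_frontier_iff_of_subgraph {e : EuclideanSpace ℝ (Fin n)}
    {γ : EuclideanSpace ℝ (Fin n) → ℝ} (hΩ : IsOpen Ω) (he : ‖e‖ = 1) (hγ : Continuous γ)
    (hγe : ∀ y (t : ℝ), γ (y + t • e) = γ y) {B : Set (EuclideanSpace ℝ (Fin n))} (hB : IsOpen B)
    (h : ∀ y ∈ B, y ∈ Ω ↔ inner ℝ y e < γ y) {y : EuclideanSpace ℝ (Fin n)} (hy : y ∈ B) :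
    y ∈ frontier Ω ↔ inner ℝ y e = γ y := by
  rw [hΩ.frontier_eq]
  constructor
  · rintro ⟨hcl, hn⟩
    refine le_antisymm ?_ (not_lt.1 fun hlt => hn ((h y hy).2 hlt))
    by_contra hlt
    push Not at hlt
    have hc : IsOpen {z : EuclideanSpace ℝ (Fin n) | γ z < inner ℝ z e} :=
      isOpen_lt hγ (by fun_prop)
    obtain ⟨z, ⟨hz1, hz2⟩, hz3⟩ := mem_closure_iff.1 hcl _ (hc.inter hB) ⟨hlt, hy⟩
    exact lt_asymm hz1 ((h z hz2).1 hz3)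
  · intro heq
    refine ⟨?_, fun hyΩ => ((h y hy).1 hyΩ).ne heq⟩
    -- A point of the graph is approached from inside `Ω` by moving against `e`, as `γ` is constant
    -- in that direction.
    have hl : Tendsto (fun t : ℝ => y + (-t) • e) (𝓝[>] 0) (𝓝 y) := by
      have : Continuous fun t : ℝ => y + (-t) • e := by fun_prop
      simpa using (this.tendsto 0).mono_left nhdsWithin_le_nhds
    refine mem_closure_of_tendsto hl ?_
    filter_upwards [hl.eventually (hB.mem_nhds hy), self_mem_nhdsWithin] with t ht ht0
    have ht0 : 0 < t := ht0
    rw [h _ ht, hγe, inner_add_left, real_inner_smul_left, real_inner_self_eq_norm_sq, he, heq]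
    linarith

/-- The divergence theorem for fields supported near a boundary point. -/
theorem exists_ball_divergence_theorem {x : EuclideanSpace ℝ (Fin n)} (hΩ : IsOpen Ω)
    (hx : ∃ e γ, IsBoundaryGraphAt Ω x e γ) : ∃ r > 0,
      surfaceMeasure Ω (Metric.ball x r) < ⊤ ∧
      ∀ G : EuclideanSpace ℝ (Fin n) → EuclideanSpace ℝ (Fin n), ContDiff ℝ 1 G →
        HasCompactSupport G → tsupport G ⊆ Metric.ball x r →
        Integrable (fun y => inner ℝ (G y) (exteriorUnitNormal Ω y)) (surfaceMeasure Ω) ∧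
        ∫ y in Ω, divergence G y =
          ∫ y, inner ℝ (G y) (exteriorUnitNormal Ω y) ∂(surfaceMeasure Ω) := by
  obtain ⟨e, γ, hg⟩ := hx
  obtain ⟨he, hγs, hγe, hev⟩ := hg
  have hγ : ContDiff ℝ 1 γ := hγs.of_le (by simp)
  obtain ⟨r, hr, hB⟩ := Metric.eventually_nhds_iff_ball.1 hev
  set B := Metric.ball x r
  have hBo : IsOpen B := Metric.isOpen_ball
  have hfr : ∀ y ∈ B, y ∈ frontier Ω ↔ inner ℝ y e = γ y := fun y hy =>
    mem_frontier_iff_of_subgraph hΩ he hγ.continuous hγe hBo hB hy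
  have hν : ∀ y ∈ B, y ∈ frontier Ω →
      exteriorUnitNormal Ω y = ‖e - gradient γ y‖⁻¹ • (e - gradient γ y) := fun y hy hyf =>
    exteriorUnitNormal_eq hΩ hyf ⟨he, hγs, hγe, by
      filter_upwards [hBo.mem_nhds hy] with z hz using hB z hz⟩
  have hN : ∀ y, 0 < ‖e - gradient γ y‖ := by
    intro y
    have h1 : inner ℝ (e - gradient γ y) e = 1 := by
      rw [inner_sub_left, (Submodule.mem_orthogonal_singleton_iff_inner_left).1
        (gradient_mem_orthogonal hγ hγe y), real_inner_self_eq_norm_sq, he]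
      norm_num
    refine norm_pos_iff.2 fun h0 => ?_
    rw [h0, inner_zero_left] at h1
    exact zero_ne_one h1
  have hgm : MeasurableSet {y : EuclideanSpace ℝ (Fin n) | inner ℝ y e = γ y} :=
    (isClosed_eq (by fun_prop) hγ.continuous).measurableSet
  have hfin : surfaceMeasure Ω B < ⊤ := by
    refine lt_of_le_of_lt ?_ (measure_graph_inter_ball_lt_top he hγ hγe (‖x‖ + r))
    rw [surfaceMeasure, Measure.restrict_apply hBo.measurableSet,
      Measure.restrict_apply Metric.isClosed_closedBall.measurableSet]
    refine measure_mono fun y hy => ⟨?_, (hfr y hy.1).1 hy.2⟩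
    have : ‖y - x‖ < r := by
      rw [← dist_eq_norm]
      exact hy.1
    rw [mem_closedBall_zero_iff]
    have h2 : ‖y‖ ≤ ‖x‖ + ‖y - x‖ := by simpa using norm_add_le x (y - x)
    linarith
  refine ⟨r, hr, hfin, fun G hG hGc hGs => ?_⟩
  have hG0 : ∀ y, y ∉ B → G y = 0 := fun y hy =>
    image_eq_zero_of_notMem_tsupport fun h => hy (hGs h)
  set f : EuclideanSpace ℝ (Fin n) → ℝ := fun y =>
    inner ℝ (G y) (‖e - gradient γ y‖⁻¹ • (e - gradient γ y)) with hf
  have hfc : Continuous f := by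
    have h1 : Continuous fun y => e - gradient γ y :=
      continuous_const.sub (continuous_gradient hγ)
    exact hG.continuous.inner ((h1.norm.inv₀ fun y => (hN y).ne').smul h1)
  have hfs : HasCompactSupport f := HasCompactSupport.intro hGc fun y hy => by
    simp [hf, image_eq_zero_of_notMem_tsupport hy]
  have hfe : ∀ y ∈ frontier Ω, inner ℝ (G y) (exteriorUnitNormal Ω y) = f y := by
    intro y hy
    by_cases hyB : y ∈ B
    · rw [hν y hyB hy]
    · simp [hf, hG0 y hyB]
  have hae : (fun y => inner ℝ (G y) (exteriorUnitNormal Ω y)) =ᵐ[surfaceMeasure Ω] f :=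
    (ae_restrict_mem isClosed_frontier.measurableSet).mono hfe
  constructor
  · refine Integrable.congr ?_ hae.symm
    obtain ⟨C, hC⟩ := hfc.bounded_above_of_compact_support hfs
    have h1 : IntegrableOn f B (surfaceMeasure Ω) :=
      Measure.integrableOn_of_bounded hfin.ne hfc.aestronglyMeasurable
        (Eventually.of_forall hC)
    refine (integrableOn_iff_integrable_of_support_subset fun y hy => ?_).1 h1
    by_contra hyB
    exact hy (by simp [hf, hG0 y hyB])
  -- `G` is supported in `B`, where `Ω` and the subgraph coincide.
  · have h1 : ∫ y in Ω, divergence G y = ∫ y in {y | inner ℝ y e < γ y}, divergence G y := by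
      rw [← integral_indicator hΩ.measurableSet,
        ← integral_indicator (isOpen_lt (by fun_prop) hγ.continuous).measurableSet]
      congr 1
      ext y
      by_cases hyB : y ∈ B
      · simp only [indicator, hB y hyB, mem_ofPred_eq]
      · have : divergence G y = 0 := divergence_eq_zero_of_notMem_tsupport fun h => hyB (hGs h)
        simp [indicator, this]
    have h2 : ∫ y, f y ∂(surfaceMeasure Ω) =
        ∫ y in {y | inner ℝ y e = γ y}, f y ∂(Measure.euclideanHausdorffMeasure (n - 1)) := by
      rw [surfaceMeasure, ← integral_indicator isClosed_frontier.measurableSet,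
        ← integral_indicator hgm]
      congr 1
      ext y
      by_cases hyB : y ∈ B
      · simp only [indicator, hfr y hyB, mem_ofPred_eq]
      · have : f y = 0 := by simp [hf, hG0 y hyB]
        simp [indicator, this]
    rw [integral_congr_ae hae, h1, h2, setIntegral_graph he hγ hγe,
      setIntegral_divergence_subgraph he hγ hγe hG hGc]
    -- The area density cancels the normalization of the exterior normal.
    refine integral_congr_ae (Eventually.of_forall fun y => ?_)
    simp only [hf, graphParam]
    rw [real_inner_smul_right, ← mul_assoc, mul_inv_cancel₀ (hN _).ne', one_mul, real_inner_comm]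

theorem divergence_sum {ι : Type*} (s : Finset ι)
    {G : ι → EuclideanSpace ℝ (Fin n) → EuclideanSpace ℝ (Fin n)} {x : EuclideanSpace ℝ (Fin n)}
    (hG : ∀ i, DifferentiableAt ℝ (G i) x) :
    divergence (fun y => ∑ i ∈ s, G i y) x = ∑ i ∈ s, divergence (G i) x := by
  simp only [divergence]
  rw [Finset.sum_comm]
  refine Finset.sum_congr rfl fun j _ => ?_
  rw [fderiv_fun_sum fun i _ => hG i]
  simp

theorem divergence_congr {G H : EuclideanSpace ℝ (Fin n) → EuclideanSpace ℝ (Fin n)}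
    {x : EuclideanSpace ℝ (Fin n)} (h : G =ᶠ[𝓝 x] H) : divergence G x = divergence H x := by
  simp only [divergence, h.fderiv_eq]

theorem IsSmoothBoundedDomain.isFiniteMeasure_surfaceMeasure (hΩ : IsSmoothBoundedDomain Ω) :
    IsFiniteMeasure (surfaceMeasure Ω) := by
  have hK : IsCompact (frontier Ω) := Metric.isCompact_of_isClosed_isBounded isClosed_frontier
    (hΩ.isBounded.closure.subset frontier_subset_closure)
  have h : surfaceMeasure Ω (frontier Ω) < ⊤ := hK.measure_lt_top_of_nhdsWithin fun x hx => by
    obtain ⟨r, hr, hfin, -⟩ := exists_ball_divergence_theorem hΩ.isOpen (hΩ.smooth_boundary x hx)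
    exact ⟨_, mem_nhdsWithin_of_mem_nhds (Metric.ball_mem_nhds x hr), hfin⟩
  refine ⟨?_⟩
  rw [surfaceMeasure] at h ⊢
  rwa [Measure.restrict_apply_self, ← Measure.restrict_apply_univ] at h

/-- The divergence theorem on a smooth bounded domain. -/
theorem IsSmoothBoundedDomain.divergence_theorem (hΩ : IsSmoothBoundedDomain Ω)
    {G : EuclideanSpace ℝ (Fin n) → EuclideanSpace ℝ (Fin n)} (hG : ContDiff ℝ 1 G) :
    Integrable (fun y => inner ℝ (G y) (exteriorUnitNormal Ω y)) (surfaceMeasure Ω) ∧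
      ∫ y in Ω, divergence G y =
        ∫ y, inner ℝ (G y) (exteriorUnitNormal Ω y) ∂(surfaceMeasure Ω) := by
  have hK : IsCompact (frontier Ω) := Metric.isCompact_of_isClosed_isBounded isClosed_frontier
    (hΩ.isBounded.closure.subset frontier_subset_closure)
  choose! r hr _ hdiv using fun x (hx : x ∈ frontier Ω) =>
    exists_ball_divergence_theorem hΩ.isOpen (hΩ.smooth_boundary x hx)
  obtain ⟨t, htf, ht⟩ := hK.elim_nhds_subcover (fun x => Metric.ball x (r x))
    fun x hx => Metric.ball_mem_nhds x (hr x hx)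
  -- Cover of the closure by `Ω` itself (index `none`) and finitely many boundary balls.
  let U : Option t → Set (EuclideanSpace ℝ (Fin n)) := fun o =>
    o.elim Ω fun x => Metric.ball (x : EuclideanSpace ℝ (Fin n)) (r x)
  have hUo : ∀ o, IsOpen (U o) := by
    rintro (_ | x)
    · exact hΩ.isOpen
    · exact Metric.isOpen_ball
  have hUb : ∀ o, Bornology.IsBounded (U o) := by
    rintro (_ | x)
    · exact hΩ.isBounded
    · exact Metric.isBounded_ball
  have hcov : closure Ω ⊆ ⋃ o, U o := by
    intro x hx
    rw [closure_eq_self_union_frontier] at hx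
    rcases hx with hx | hx
    · exact mem_iUnion.2 ⟨none, hx⟩
    · obtain ⟨y, hy, hxy⟩ := mem_iUnion₂.1 (ht hx)
      exact mem_iUnion.2 ⟨some ⟨y, hy⟩, hxy⟩
  obtain ⟨f, hf⟩ := SmoothPartitionOfUnity.exists_isSubordinate
    𝓘(ℝ, EuclideanSpace ℝ (Fin n)) (isClosed_closure (s := Ω)) U hUo hcov
  have hfc : ∀ o, ContDiff ℝ 1 (f o) := fun o => (f o).contMDiff.contDiff.of_le (by simp)
  have hfsum : ∀ x ∈ closure Ω, ∑ o, f o x = 1 := fun x hx => by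
    rw [← finsum_eq_sum_of_fintype]
    exact f.sum_eq_one hx
  set H : Option t → EuclideanSpace ℝ (Fin n) → EuclideanSpace ℝ (Fin n) := fun o x =>
    f o x • G x with hH
  have hHc : ∀ o, ContDiff ℝ 1 (H o) := fun o => (hfc o).smul hG
  have hHt : ∀ o, tsupport (H o) ⊆ tsupport (f o) := fun o => tsupport_smul_subset_left _ _
  have hHs : ∀ o, HasCompactSupport (H o) := fun o =>
    Metric.isCompact_of_isClosed_isBounded (isClosed_tsupport _)
      ((hUb o).subset ((hHt o).trans (hf o)))
  have key : ∀ o, Integrable (fun y => inner ℝ (H o y) (exteriorUnitNormal Ω y))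
      (surfaceMeasure Ω) ∧ ∫ y in Ω, divergence (H o) y =
        ∫ y, inner ℝ (H o y) (exteriorUnitNormal Ω y) ∂(surfaceMeasure Ω) := by
    rintro (_ | x)
    -- The interior piece has compact support in `Ω`, so both its flux and its total divergence
    -- vanish.
    · have h0 : (fun y => inner ℝ (H none y) (exteriorUnitNormal Ω y))
          =ᵐ[surfaceMeasure Ω] fun _ => 0 := by
        refine (ae_restrict_mem isClosed_frontier.measurableSet).mono fun y hy => ?_
        have hy' : H none y = 0 := image_eq_zero_of_notMem_tsupport fun h => by
          have := hf none (hHt none h)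
          rw [hΩ.isOpen.frontier_eq] at hy
          exact hy.2 this
        simp [hy']
      refine ⟨(integrable_zero _ _ _).congr h0.symm, ?_⟩
      rw [integral_congr_ae h0, integral_zero,
        setIntegral_eq_integral_of_forall_compl_eq_zero (s := Ω) fun y hy =>
          divergence_eq_zero_of_notMem_tsupport fun h => hy (hf none (hHt none h))]
      simpa using integral_mul_divergence (h := fun _ => 1) contDiff_const (hHc none) (hHs none)
    · exact hdiv x (htf x x.2) (H (some x)) (hHc _) (hHs _) ((hHt _).trans (hf (some x)))
  have hb : (fun y => inner ℝ (G y) (exteriorUnitNormal Ω y)) =ᵐ[surfaceMeasure Ω]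
      fun y => ∑ o, inner ℝ (H o y) (exteriorUnitNormal Ω y) := by
    refine (ae_restrict_mem isClosed_frontier.measurableSet).mono fun y hy => ?_
    simp only [hH]
    rw [← sum_inner, ← Finset.sum_smul, hfsum y (frontier_subset_closure hy), one_smul]
  have hd : ∀ y ∈ Ω, divergence G y = ∑ o, divergence (H o) y := by
    intro y hy
    rw [← divergence_sum _ fun o => (hHc o).differentiable (by simp) y]
    refine divergence_congr ?_
    filter_upwards [hΩ.isOpen.mem_nhds hy] with z hz
    simp only [hH]
    rw [← Finset.sum_smul, hfsum z (subset_closure hz), one_smul]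
  refine ⟨(integrable_finsetSum _ fun o _ => (key o).1).congr hb.symm, ?_⟩
  rw [integral_congr_ae hb, integral_finsetSum _ fun o _ => (key o).1,
    setIntegral_congr_fun hΩ.isOpen.measurableSet hd, integral_finsetSum _ fun o _ => ?_]
  · exact Finset.sum_congr rfl fun o _ => (key o).2
  · exact ((continuous_divergence (hHc o)).integrable_of_hasCompactSupport
      (hasCompactSupport_divergence (hHs o))).integrableOn

end DivergenceTheorem

/-! ### The regularized flux and bounds uniform in the parameter. -/

section RegularizedFlux

variable {n : ℕ} {p s : ℝ} {a u : EuclideanSpace ℝ (Fin n) → ℝ} {x : EuclideanSpace ℝ (Fin n)}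

/-- The vector field `a (|∇u|² + s)^((p-2)/2) ∇u`, which regularizes `a |∇u|^(p-2) ∇u`. -/
noncomputable def regularizedFlux (p : ℝ) (a u : EuclideanSpace ℝ (Fin n) → ℝ) (s : ℝ)
    (x : EuclideanSpace ℝ (Fin n)) : EuclideanSpace ℝ (Fin n) :=
  (a x * (‖gradient u x‖ ^ 2 + s) ^ ((p - 2) / 2)) • gradient u x

theorem regularizedFlux_zero : regularizedFlux p a u 0 = pFlux p a u := by
  ext1 x
  rw [regularizedFlux, pFlux, add_zero, ← Real.rpow_natCast, ← Real.rpow_mul (norm_nonneg _)]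
  congr 4
  push_cast
  ring

theorem contDiff_gradient (hu : ContDiff ℝ ∞ u) : ContDiff ℝ ∞ (gradient u) :=
  (InnerProductSpace.toDual ℝ (EuclideanSpace ℝ (Fin n))).symm.contDiff.comp
    (hu.fderiv_right (by simp))

theorem contDiffAt_regularizedFlux (ha : ContDiff ℝ 1 a) (hu : ContDiff ℝ ∞ u)
    (hx : ‖gradient u x‖ ^ 2 + s ≠ 0) : ContDiffAt ℝ 1 (regularizedFlux p a u s) x := by
  have hg : ContDiff ℝ 1 (gradient u) := (contDiff_gradient hu).of_le (by simp)
  have h1 : ContDiffAt ℝ 1 (fun y => ‖gradient u y‖ ^ 2 + s) x :=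
    ((hg.norm_sq ℝ).add contDiff_const).contDiffAt
  exact (ha.contDiffAt.mul (h1.rpow_const_of_ne hx)).smul hg.contDiffAt

theorem contDiff_regularizedFlux (ha : ContDiff ℝ 1 a) (hu : ContDiff ℝ ∞ u) (hs : 0 < s) :
    ContDiff ℝ 1 (regularizedFlux p a u s) :=
  contDiff_iff_contDiffAt.2 fun _ => contDiffAt_regularizedFlux ha hu (by positivity)

theorem divergence_smul {f : EuclideanSpace ℝ (Fin n) → ℝ}
    {G : EuclideanSpace ℝ (Fin n) → EuclideanSpace ℝ (Fin n)} (hf : DifferentiableAt ℝ f x)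
    (hG : DifferentiableAt ℝ G x) :
    divergence (fun y => f y • G y) x = f x * divergence G x + fderiv ℝ f x (G x) := by
  simp only [divergence]
  rw [fderiv_fun_smul hf hG, Finset.mul_sum]
  conv_rhs => rw [← euclidean_sum_smul_single (G x), map_sum]
  rw [← Finset.sum_add_distrib]
  refine Finset.sum_congr rfl fun i _ => ?_
  simp only [add_apply, smul_apply, ContinuousLinearMap.smulRight_apply, PiLp.add_apply,
    PiLp.smul_apply, smul_eq_mul, map_smul]
  ring

theorem divergence_regularizedFlux (ha : ContDiff ℝ 1 a) (hu : ContDiff ℝ ∞ u)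
    (hx : ‖gradient u x‖ ^ 2 + s ≠ 0) :
    divergence (regularizedFlux p a u s) x =
      a x * (‖gradient u x‖ ^ 2 + s) ^ ((p - 2) / 2) * divergence (gradient u) x +
      (a x * ((p - 2) * (‖gradient u x‖ ^ 2 + s) ^ ((p - 2) / 2 - 1) *
        inner ℝ (gradient u x) (fderiv ℝ (gradient u) x (gradient u x))) +
      (‖gradient u x‖ ^ 2 + s) ^ ((p - 2) / 2) * fderiv ℝ a x (gradient u x)) := by
  have hg : ContDiff ℝ 1 (gradient u) := (contDiff_gradient hu).of_le (by simp)
  have hgx := (hg.differentiable (by simp) x)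
  have h1 := (hgx.hasFDerivAt.norm_sq.add_const s).rpow_const (p := (p - 2) / 2) (Or.inl hx)
  have h2 := (ha.differentiable (by simp) x).hasFDerivAt.mul h1
  have h3 : fderiv ℝ (fun y => a y * (‖gradient u y‖ ^ 2 + s) ^ ((p - 2) / 2)) x = _ := h2.fderiv
  have h4 := divergence_smul (x := x)
    (f := fun y => a y * (‖gradient u y‖ ^ 2 + s) ^ ((p - 2) / 2)) h2.differentiableAt hgx
  refine h4.trans ?_
  rw [h3]
  simp only [add_apply, smul_apply, ContinuousLinearMap.comp_apply, smul_eq_mul,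
    innerSL_apply_apply, nsmul_eq_mul]
  push_cast
  ring

theorem norm_le_sum_abs (v : EuclideanSpace ℝ (Fin n)) : ‖v‖ ≤ ∑ j, |v j| := by
  conv_lhs => rw [← euclidean_sum_smul_single v]
  refine (norm_sum_le _ _).trans (Finset.sum_le_sum fun j _ => ?_)
  rw [norm_smul, PiLp.norm_single, norm_one, mul_one, Real.norm_eq_abs]

theorem opNorm_le_sum_abs
    (L : EuclideanSpace ℝ (Fin n) →L[ℝ] EuclideanSpace ℝ (Fin n)) :
    ‖L‖ ≤ ∑ i, ∑ j, |L (EuclideanSpace.single i 1) j| := by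
  refine L.opNorm_le_bound (by positivity) fun v => ?_
  conv_lhs => rw [← euclidean_sum_smul_single v, map_sum]
  rw [Finset.sum_mul]
  refine (norm_sum_le _ _).trans (Finset.sum_le_sum fun i _ => ?_)
  rw [map_smul, norm_smul, mul_comm]
  exact mul_le_mul (norm_le_sum_abs _) (PiLp.norm_apply_le v i) (norm_nonneg _) (by positivity)

theorem abs_divergence_le (G : EuclideanSpace ℝ (Fin n) → EuclideanSpace ℝ (Fin n))
    (x : EuclideanSpace ℝ (Fin n)) : |divergence G x| ≤ n * ‖fderiv ℝ G x‖ := by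
  refine (Finset.abs_sum_le_sum_abs _ _).trans ?_
  refine (Finset.sum_le_card_nsmul _ _ ‖fderiv ℝ G x‖ fun i _ => ?_).trans (by simp)
  refine (PiLp.norm_apply_le (fderiv ℝ G x (EuclideanSpace.single i 1)) i).trans ?_
  simpa using (fderiv ℝ G x).le_opNorm (EuclideanSpace.single i 1)

/-- One factor `‖v‖ ≤ (‖v‖² + s)^(1/2)` raises the exponent to the positive number `(p-1)/2`, so the
bound is uniform in `s` even when `p < 2`. -/
theorem rpow_mul_norm_le (hp : 1 < p) (hs : 0 ≤ s) (hs1 : s ≤ 1) (v : EuclideanSpace ℝ (Fin n)) :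
    (‖v‖ ^ 2 + s) ^ ((p - 2) / 2) * ‖v‖ ≤ (‖v‖ ^ 2 + 1) ^ ((p - 1) / 2) := by
  rcases eq_or_ne v 0 with rfl | hv
  · simp
  have hv := norm_pos_iff.2 hv
  have h1 : ‖v‖ ≤ (‖v‖ ^ 2 + s) ^ (1 / 2 : ℝ) := by
    rw [← Real.sqrt_eq_rpow]
    exact Real.le_sqrt_of_sq_le (by linarith)
  calc (‖v‖ ^ 2 + s) ^ ((p - 2) / 2) * ‖v‖
      ≤ (‖v‖ ^ 2 + s) ^ ((p - 2) / 2) * (‖v‖ ^ 2 + s) ^ (1 / 2 : ℝ) := by gcongr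
    _ = (‖v‖ ^ 2 + s) ^ ((p - 1) / 2) := by
      rw [← Real.rpow_add (by positivity)]
      ring_nf
    _ ≤ _ := Real.rpow_le_rpow (by positivity) (by linarith) (by linarith)

theorem norm_regularizedFlux_le (hp : 1 < p) (hs : 0 ≤ s) (hs1 : s ≤ 1) :
    ‖regularizedFlux p a u s x‖ ≤ |a x| * (‖gradient u x‖ ^ 2 + 1) ^ ((p - 1) / 2) := by
  rw [regularizedFlux, norm_smul, norm_mul, Real.norm_eq_abs, mul_assoc,
    Real.norm_of_nonneg (by positivity)]
  exact mul_le_mul_of_nonneg_left (rpow_mul_norm_le hp hs hs1 _) (abs_nonneg _)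

/-- Monotonicity in `s`: the value at `s = 1` dominates for `p ≥ 2`, the value at `s = 0` for `p ≤
2`. The sum covers both cases. -/
theorem rpow_le_rpow_add_rpow (hs : 0 ≤ s) (hs1 : s ≤ 1) {v : EuclideanSpace ℝ (Fin n)}
    (hv : v ≠ 0) : (‖v‖ ^ 2 + s) ^ ((p - 2) / 2) ≤
      ‖v‖ ^ (p - 2) + (‖v‖ ^ 2 + 1) ^ ((p - 2) / 2) := by
  have hv := norm_pos_iff.2 hv
  have h2 : ‖v‖ ^ (p - 2) = (‖v‖ ^ 2) ^ ((p - 2) / 2) := by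
    rw [← Real.rpow_natCast, ← Real.rpow_mul (norm_nonneg _)]
    congr 1
    push_cast
    ring
  rcases le_total 2 p with hp | hp
  · refine le_add_of_nonneg_of_le (by positivity) ?_
    exact Real.rpow_le_rpow (by positivity) (by linarith) (by linarith)
  · refine le_add_of_le_of_nonneg ?_ (by positivity)
    rw [h2]
    exact Real.rpow_le_rpow_of_nonpos (by positivity) (by linarith) (by linarith)

/-- A bound, uniform in `s`, for the divergence of the regularized flux. -/
noncomputable def fluxDivergenceBound (p : ℝ) (a u : EuclideanSpace ℝ (Fin n) → ℝ)
    (x : EuclideanSpace ℝ (Fin n)) : ℝ :=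
  |a x| * (n + |p - 2|) * (‖fderiv ℝ (gradient u) x‖ * ‖gradient u x‖ ^ (p - 2) +
      ‖fderiv ℝ (gradient u) x‖ * (‖gradient u x‖ ^ 2 + 1) ^ ((p - 2) / 2)) +
    ‖fderiv ℝ a x‖ * (‖gradient u x‖ ^ 2 + 1) ^ ((p - 1) / 2)

theorem fluxDivergenceBound_nonneg : 0 ≤ fluxDivergenceBound p a u x := by
  unfold fluxDivergenceBound
  positivity

theorem abs_divergence_regularizedFlux_le (hp : 1 < p) (ha : ContDiff ℝ 1 a)
    (hu : ContDiff ℝ ∞ u) (hs : 0 ≤ s) (hs1 : s ≤ 1) (hx : gradient u x ≠ 0) :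
    |divergence (regularizedFlux p a u s) x| ≤ fluxDivergenceBound p a u x := by
  have hN := norm_pos_iff.2 hx
  have hy : 0 < ‖gradient u x‖ ^ 2 + s := by positivity
  rw [divergence_regularizedFlux ha hu hy.ne', fluxDivergenceBound]
  have h1 := abs_divergence_le (gradient u) x
  have h2 := rpow_le_rpow_add_rpow (p := p) hs hs1 hx
  have h3 := rpow_mul_norm_le hp hs hs1 (gradient u x)
  have h4 : |inner ℝ (gradient u x) (fderiv ℝ (gradient u) x (gradient u x))| ≤
      ‖fderiv ℝ (gradient u) x‖ * (‖gradient u x‖ ^ 2 + s) := by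
    refine (abs_real_inner_le_norm _ _).trans ?_
    have := (fderiv ℝ (gradient u) x).le_opNorm (gradient u x)
    have h5 : ‖fderiv ℝ (gradient u) x‖ * ‖gradient u x‖ ^ 2 ≤
      ‖fderiv ℝ (gradient u) x‖ * (‖gradient u x‖ ^ 2 + s) := by gcongr; linarith
    nlinarith
  have h5 := (fderiv ℝ a x).le_opNorm (gradient u x)
  rw [Real.norm_eq_abs] at h5
  set g := gradient u x
  set D := ‖fderiv ℝ (gradient u) x‖
  have hW : 0 ≤ (‖g‖ ^ 2 + s) ^ ((p - 2) / 2) := by positivity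
  -- Differentiating the power lowers its exponent by one; the two factors of the gradient in the
  -- Hessian term restore it.
  have hW1 : (‖g‖ ^ 2 + s) ^ ((p - 2) / 2 - 1) * (‖g‖ ^ 2 + s) = (‖g‖ ^ 2 + s) ^ ((p - 2) / 2) := by
    rw [← Real.rpow_add_one hy.ne', sub_add_cancel]
  have hW2 : 0 ≤ (‖g‖ ^ 2 + s) ^ ((p - 2) / 2 - 1) := by positivity
  set W := (‖g‖ ^ 2 + s) ^ ((p - 2) / 2)
  set W' := (‖g‖ ^ 2 + s) ^ ((p - 2) / 2 - 1)
  have hD : 0 ≤ D := norm_nonneg _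
  have t1 : |a x * W * divergence (gradient u) x| ≤ |a x| * (n * (D * W)) := by
    rw [abs_mul, abs_mul, abs_of_nonneg hW]
    calc |a x| * W * |divergence (gradient u) x| ≤ |a x| * W * (n * D) := by gcongr
      _ = _ := by ring
  have t2 : |a x * ((p - 2) * W' * inner ℝ g (fderiv ℝ (gradient u) x g))| ≤
      |a x| * (|p - 2| * (D * W)) := by
    rw [abs_mul, abs_mul, abs_mul, abs_of_nonneg hW2]
    calc |a x| * (|p - 2| * W' * |inner ℝ g (fderiv ℝ (gradient u) x g)|)
        ≤ |a x| * (|p - 2| * W' * (D * (‖g‖ ^ 2 + s))) := by gcongr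
      _ = |a x| * (|p - 2| * (D * (W' * (‖g‖ ^ 2 + s)))) := by ring
      _ = _ := by rw [hW1]
  have t3 : |W * fderiv ℝ a x g| ≤ ‖fderiv ℝ a x‖ * (‖g‖ ^ 2 + 1) ^ ((p - 1) / 2) := by
    rw [abs_mul, abs_of_nonneg hW]
    calc W * |fderiv ℝ a x g| ≤ W * (‖fderiv ℝ a x‖ * ‖g‖) := by gcongr
      _ = ‖fderiv ℝ a x‖ * (W * ‖g‖) := by ring
      _ ≤ _ := by gcongr
  have t4 : |a x| * (n + |p - 2|) * (D * W) ≤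
      |a x| * (n + |p - 2|) * (D * ‖g‖ ^ (p - 2) + D * (‖g‖ ^ 2 + 1) ^ ((p - 2) / 2)) := by
    rw [← mul_add]
    gcongr
  refine (abs_add_le _ _).trans ?_
  have := abs_add_le (a x * ((p - 2) * W' * inner ℝ g (fderiv ℝ (gradient u) x g)))
    (W * fderiv ℝ a x g)
  linarith

/-- Each partial derivative of `u` has vanishing derivative almost everywhere on its zero set. This
disposes of the critical points of `u`. -/
theorem ae_fderiv_gradient_eq_zero (hu : ContDiff ℝ ∞ u) :
    ∀ᵐ x, ∀ i j, gradient u x j = 0 →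
      fderiv ℝ (gradient u) x (EuclideanSpace.single i 1) j = 0 := by
  have hg := contDiff_gradient hu
  rw [ae_all_iff]; intro i
  rw [ae_all_iff]; intro j
  have hj : ContDiff ℝ ∞ fun x => gradient u x j := (EuclideanSpace.proj (𝕜 := ℝ) j).contDiff.comp hg
  filter_upwards [ae_fderiv_apply_eq_zero_of_eq_zero (μ := volume) hj.continuous.measurable
    (EuclideanSpace.single i 1)] with x hx h0
  rw [← fderiv_coord_apply (hg.differentiable (by simp) x)]
  exact hx h0 (hj.differentiable (by simp) x)

/-- Only `p < 2` is singular. There the negative exponent gives `‖∇u‖^(p-2) ≤ |∂ⱼu|^(p-2)` wherever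
`∂ⱼu ≠ 0`, and each `|∂ᵢ∂ⱼu||∂ⱼu|^(p-2)` is integrable by the root estimate with `α = p - 1`. -/
theorem integrableOn_norm_fderiv_gradient_mul_rpow (hp : 1 < p) (hu : ContDiff ℝ ∞ u) (R : ℝ) :
    IntegrableOn (fun x => ‖fderiv ℝ (gradient u) x‖ * ‖gradient u x‖ ^ (p - 2))
      (Metric.closedBall 0 R) := by
  have hg := contDiff_gradient hu
  have hDc : Continuous fun x => ‖fderiv ℝ (gradient u) x‖ := (hg.continuous_fderiv (by simp)).norm
  rcases le_or_gt 2 p with h2 | h2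
  · exact (hDc.mul (hg.continuous.norm.rpow_const fun _ => Or.inr (by linarith))).continuousOn
      |>.integrableOn_compact (isCompact_closedBall _ _)
  have hj : ∀ j, ContDiff ℝ ∞ fun x => gradient u x j := fun j =>
    (EuclideanSpace.proj (𝕜 := ℝ) j).contDiff.comp hg
  have hint : IntegrableOn (fun x => ∑ i, ∑ j,
      |fderiv ℝ (fun y => gradient u y j) x (EuclideanSpace.single i 1)| *
        |gradient u x j| ^ (p - 1 - 1)) (Metric.closedBall 0 R) :=
    integrable_finsetSum _ fun i _ => integrable_finsetSum _ fun j _ =>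
      integrableOn_abs_fderiv_mul_rpow (hj j) _ (by linarith) (by linarith) R
  refine hint.mono' ?_ ?_
  · exact (hDc.measurable.mul (hg.continuous.norm.measurable.pow_const _)).aestronglyMeasurable
  · refine ae_restrict_of_ae ?_
    filter_upwards [ae_fderiv_gradient_eq_zero hu] with x hx
    rw [Real.norm_of_nonneg (by positivity)]
    rcases eq_or_ne (gradient u x) 0 with h0 | h0
    · rw [h0, norm_zero, Real.zero_rpow (by linarith), mul_zero]
      positivity
    refine (mul_le_mul_of_nonneg_right (opNorm_le_sum_abs _) (by positivity)).trans ?_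
    simp only [Finset.sum_mul]
    refine Finset.sum_le_sum fun i _ => Finset.sum_le_sum fun j _ => ?_
    rw [fderiv_coord_apply (hg.differentiable (by simp) x)]
    -- Where `∂ⱼu = 0` the comparison of powers fails, but `∂ᵢ∂ⱼu` vanishes almost everywhere there.
    rcases eq_or_ne (gradient u x j) 0 with hj0 | hj0
    · simp [hx i j hj0]
    · refine mul_le_mul_of_nonneg_left ?_ (abs_nonneg _)
      rw [show p - 1 - 1 = p - 2 by ring]
      exact Real.rpow_le_rpow_of_nonpos (abs_pos.2 hj0) (PiLp.norm_apply_le (gradient u x) j)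
        (by linarith)

theorem integrableOn_fluxDivergenceBound (hp : 1 < p) (ha : ContDiff ℝ 1 a) (hu : ContDiff ℝ ∞ u)
    (R : ℝ) : IntegrableOn (fluxDivergenceBound p a u) (Metric.closedBall 0 R) := by
  have hg := contDiff_gradient hu
  have hDc : Continuous fun x => ‖fderiv ℝ (gradient u) x‖ := (hg.continuous_fderiv (by simp)).norm
  have hac : Continuous fun x => ‖fderiv ℝ a x‖ := (ha.continuous_fderiv (by simp)).norm
  have hpow : ∀ q : ℝ, Continuous fun x => (‖gradient u x‖ ^ 2 + 1) ^ q := fun q =>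
    ((hg.continuous.norm.pow 2).add continuous_const).rpow_const fun x =>
      Or.inl (add_pos_of_nonneg_of_pos (sq_nonneg _) one_pos).ne'
  have hK := isCompact_closedBall (0 : EuclideanSpace ℝ (Fin n)) R
  have h1 : IntegrableOn (fun x => ‖fderiv ℝ (gradient u) x‖ * ‖gradient u x‖ ^ (p - 2) +
      ‖fderiv ℝ (gradient u) x‖ * (‖gradient u x‖ ^ 2 + 1) ^ ((p - 2) / 2))
      (Metric.closedBall 0 R) :=
    (integrableOn_norm_fderiv_gradient_mul_rpow hp hu R).add
      ((hDc.mul (hpow _)).continuousOn.integrableOn_compact hK)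
  have h2 : Continuous fun x => |a x| * (n + |p - 2|) := ha.continuous.abs.mul continuous_const
  exact (h1.continuousOn_mul h2.continuousOn hK).add
    ((hac.mul (hpow _)).continuousOn.integrableOn_compact hK)

end RegularizedFlux

/-! ### Integration by parts for the degenerate flux. -/

section WeakFormulation

variable {n : ℕ} {p : ℝ} {a u : EuclideanSpace ℝ (Fin n) → ℝ}
  {Ω : Set (EuclideanSpace ℝ (Fin n))}

theorem measurable_gradient (f : EuclideanSpace ℝ (Fin n) → ℝ) : Measurable (gradient f) :=
  (InnerProductSpace.toDual ℝ _).symm.continuous.measurable.comp (measurable_fderiv ℝ f)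

theorem measurable_pFlux (ha : Measurable a) : Measurable (pFlux p a u) :=
  (ha.mul ((measurable_gradient u).norm.pow_const _)).smul (measurable_gradient u)

theorem tendsto_regularizedFlux (x : EuclideanSpace ℝ (Fin n)) :
    Tendsto (fun s => regularizedFlux p a u s x) (𝓝[>] 0) (𝓝 (pFlux p a u x)) := by
  rw [← regularizedFlux_zero]
  by_cases hx : gradient u x = 0
  · simp [regularizedFlux, hx]
  · have hN := norm_pos_iff.2 hx
    have h1 : Tendsto (fun s : ℝ => ‖gradient u x‖ ^ 2 + s) (𝓝[>] 0)
        (𝓝 (‖gradient u x‖ ^ 2 + 0)) := (tendsto_id.mono_left nhdsWithin_le_nhds).const_add _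
    have hne : ‖gradient u x‖ ^ 2 + 0 ≠ 0 := by positivity
    exact ((h1.rpow_const (Or.inl hne)).const_mul _).smul_const _

theorem divergence_regularizedFlux_eq_zero {s : ℝ} {x : EuclideanSpace ℝ (Fin n)}
    (ha : ContDiff ℝ 1 a) (hu : ContDiff ℝ ∞ u) (hs : 0 < s) (hx : gradient u x = 0)
    (hD : ∀ i j, gradient u x j = 0 → fderiv ℝ (gradient u) x (EuclideanSpace.single i 1) j = 0) :
    divergence (regularizedFlux p a u s) x = 0 := by
  have h0 : divergence (gradient u) x = 0 :=
    Finset.sum_eq_zero fun i _ => hD i i (by simp [hx])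
  rw [divergence_regularizedFlux ha hu (by positivity), h0, hx]
  simp

theorem ae_abs_divergence_regularizedFlux_le (hp : 1 < p) (ha : ContDiff ℝ 1 a)
    (hu : ContDiff ℝ ∞ u) : ∀ᵐ x, ∀ s, 0 < s → s ≤ 1 →
      |divergence (regularizedFlux p a u s) x| ≤ fluxDivergenceBound p a u x := by
  filter_upwards [ae_fderiv_gradient_eq_zero hu] with x hx s hs hs1
  by_cases h0 : gradient u x = 0
  · rw [divergence_regularizedFlux_eq_zero ha hu hs h0 hx, abs_zero]
    exact fluxDivergenceBound_nonneg
  · exact abs_divergence_regularizedFlux_le hp ha hu hs.le hs1 h0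

/-- Away from critical points the explicit formula is continuous in `s` down to `0`. At almost every
critical point where the flux is differentiable all the divergences are zero: the Hessian vanishes
there, and so does the relevant derivative of each component of the flux, since the component itself
is zero. -/
theorem ae_tendsto_divergence_regularizedFlux (ha : ContDiff ℝ 1 a) (hu : ContDiff ℝ ∞ u) :
    ∀ᵐ x, DifferentiableAt ℝ (pFlux p a u) x →
      Tendsto (fun s => divergence (regularizedFlux p a u s) x) (𝓝[>] 0)
        (𝓝 (divergence (pFlux p a u) x)) := by
  have hae : ∀ᵐ x, ∀ i : Fin n, pFlux p a u x i = 0 →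
      DifferentiableAt ℝ (fun y => pFlux p a u y i) x →
        fderiv ℝ (fun y => pFlux p a u y i) x (EuclideanSpace.single i 1) = 0 :=
    ae_all_iff.2 fun i => ae_fderiv_apply_eq_zero_of_eq_zero
      ((EuclideanSpace.proj (𝕜 := ℝ) i).continuous.measurable.comp
        (measurable_pFlux ha.continuous.measurable)) _
  filter_upwards [ae_fderiv_gradient_eq_zero hu, hae] with x hx hF hdiff
  by_cases h0 : gradient u x = 0
  · have h1 : divergence (pFlux p a u) x = 0 := by
      refine Finset.sum_eq_zero fun i _ => ?_
      rw [← fderiv_coord_apply hdiff]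
      refine hF i (by simp [pFlux, h0]) ?_
      exact (EuclideanSpace.proj (𝕜 := ℝ) i).differentiableAt.comp x hdiff
    rw [h1]
    refine tendsto_const_nhds.congr' ?_
    filter_upwards [self_mem_nhdsWithin] with s hs
    exact (divergence_regularizedFlux_eq_zero ha hu hs h0 hx).symm
  · have hN := norm_pos_iff.2 h0
    have hne : ‖gradient u x‖ ^ 2 + 0 ≠ 0 := by positivity
    have h1 : Tendsto (fun s : ℝ => ‖gradient u x‖ ^ 2 + s) (𝓝[>] 0)
        (𝓝 (‖gradient u x‖ ^ 2 + 0)) := (tendsto_id.mono_left nhdsWithin_le_nhds).const_add _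
    rw [← regularizedFlux_zero, divergence_regularizedFlux ha hu hne]
    have h2 := h1.rpow_const (p := (p - 2) / 2) (Or.inl hne)
    have h3 := h1.rpow_const (p := (p - 2) / 2 - 1) (Or.inl hne)
    refine Tendsto.congr' ?_ (((h2.const_mul (a x)).mul_const (divergence (gradient u) x)).add
      ((((h3.const_mul (p - 2)).mul_const
        (inner ℝ (gradient u x) (fderiv ℝ (gradient u) x (gradient u x)))).const_mul (a x)).add
        (h2.mul_const (fderiv ℝ a x (gradient u x)))))
    filter_upwards [self_mem_nhdsWithin] with s hs
    have hs : 0 < s := hs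
    exact (divergence_regularizedFlux ha hu (by positivity)).symm

/-- Integration by parts for the field `a |∇u|^(p-2) ∇u`. -/
theorem integral_mul_divergence_pFlux (hp : 1 < p) (hΩ : IsSmoothBoundedDomain Ω)
    (ha : ContDiff ℝ 1 a) (hu : ContDiff ℝ ∞ u) {ψ : EuclideanSpace ℝ (Fin n) → ℝ}
    (hψ : ContDiff ℝ 1 ψ)
    (hdiff : ∀ᵐ x ∂(volume.restrict Ω), DifferentiableAt ℝ (pFlux p a u) x) :
    IntegrableOn (fun x => ψ x * divergence (pFlux p a u) x) Ω ∧
      IntegrableOn (fun x => fderiv ℝ ψ x (pFlux p a u x)) Ω ∧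
      Integrable (fun x => ψ x * inner ℝ (pFlux p a u x) (exteriorUnitNormal Ω x))
        (surfaceMeasure Ω) ∧
      (∫ x in Ω, ψ x * divergence (pFlux p a u) x) + ∫ x in Ω, fderiv ℝ ψ x (pFlux p a u x) =
        ∫ x, ψ x * inner ℝ (pFlux p a u x) (exteriorUnitNormal Ω x) ∂(surfaceMeasure Ω) := by
  have hfin := hΩ.isFiniteMeasure_surfaceMeasure
  have hvol : IsFiniteMeasure (volume.restrict Ω) :=
    ⟨by rw [Measure.restrict_apply_univ]; exact hΩ.isBounded.measure_lt_top⟩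
  have hK : IsCompact (closure Ω) :=
    Metric.isCompact_of_isClosed_isBounded isClosed_closure hΩ.isBounded.closure
  have hg := contDiff_gradient hu
  set s : ℕ → ℝ := fun k => 1 / ((k : ℝ) + 1) with hs_def
  have hs0 : ∀ k, 0 < s k := fun k => by positivity
  have hs1 : ∀ k, s k ≤ 1 := fun k => by
    rw [hs_def]
    simp only
    rw [div_le_one (by positivity)]
    linarith [(Nat.cast_nonneg k : (0 : ℝ) ≤ k)]
  have hs : Tendsto s atTop (𝓝[>] 0) := tendsto_nhdsWithin_iff.2
    ⟨tendsto_one_div_add_atTop_nhds_zero_nat, Eventually.of_forall hs0⟩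
  set F : ℕ → EuclideanSpace ℝ (Fin n) → EuclideanSpace ℝ (Fin n) := fun k =>
    regularizedFlux p a u (s k) with hF
  have hFc : ∀ k, ContDiff ℝ 1 (F k) := fun k => contDiff_regularizedFlux ha hu (hs0 k)
  have hFt : ∀ x, Tendsto (fun k => F k x) atTop (𝓝 (pFlux p a u x)) := fun x =>
    (tendsto_regularizedFlux x).comp hs
  have hdc : Continuous fun x => fderiv ℝ ψ x := hψ.continuous_fderiv (by simp)
  have hbc : Continuous fun x => |a x| * (‖gradient u x‖ ^ 2 + 1) ^ ((p - 1) / 2) :=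
    ha.continuous.abs.mul (((hg.continuous.norm.pow 2).add continuous_const).rpow_const fun x =>
      Or.inl (add_pos_of_nonneg_of_pos (sq_nonneg _) one_pos).ne')
  obtain ⟨C₁, hC₁⟩ := hK.exists_bound_of_continuousOn (hdc.norm.mul hbc).continuousOn
  obtain ⟨C₂, hC₂⟩ := hK.exists_bound_of_continuousOn (hψ.continuous.norm.mul hbc).continuousOn
  obtain ⟨C₃, hC₃⟩ := hK.exists_bound_of_continuousOn hψ.continuous.continuousOn
  -- the terms of the identity for the regularized flux, and their limits
  have hFb : ∀ k x, ‖F k x‖ ≤ |a x| * (‖gradient u x‖ ^ 2 + 1) ^ ((p - 1) / 2) := fun k x =>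
    norm_regularizedFlux_le hp (hs0 k).le (hs1 k)
  have b1 : ∀ k, ∀ᵐ x ∂(volume.restrict Ω), ‖fderiv ℝ ψ x (F k x)‖ ≤ C₁ := fun k => by
    filter_upwards [ae_restrict_mem hΩ.isOpen.measurableSet] with x hx
    refine ((fderiv ℝ ψ x).le_opNorm _).trans (le_trans ?_ (hC₁ x (subset_closure hx)))
    exact (mul_le_mul_of_nonneg_left (hFb k x) (norm_nonneg _)).trans (le_abs_self _)
  have b2 : ∀ k, ∀ᵐ x ∂(surfaceMeasure Ω),
      ‖ψ x * inner ℝ (F k x) (exteriorUnitNormal Ω x)‖ ≤ C₂ := fun k => by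
    filter_upwards [ae_restrict_mem isClosed_frontier.measurableSet] with x hx
    refine le_trans ?_ (hC₂ x (frontier_subset_closure hx))
    refine le_trans ?_ (le_abs_self _)
    rw [norm_mul]
    refine mul_le_mul_of_nonneg_left ?_ (norm_nonneg _)
    refine (norm_inner_le_norm _ _).trans ((mul_le_of_le_one_right (norm_nonneg _)
      (norm_exteriorUnitNormal_le x)).trans (hFb k x))
  have b3 : ∀ k, ∀ᵐ x ∂(volume.restrict Ω), ‖ψ x * divergence (F k) x‖ ≤
      C₃ * fluxDivergenceBound p a u x := fun k => by
    filter_upwards [ae_restrict_mem hΩ.isOpen.measurableSet,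
      ae_restrict_of_ae (ae_abs_divergence_regularizedFlux_le hp ha hu)] with x hx hb
    rw [norm_mul]
    exact mul_le_mul (hC₃ x (subset_closure hx)) (hb _ (hs0 k) (hs1 k)) (norm_nonneg _)
      ((norm_nonneg _).trans (hC₃ x (subset_closure hx)))
  -- The other two terms are dominated by constants; only the divergence term needs the integrable
  -- singular bound.
  have i3 : Integrable (fun x => C₃ * fluxDivergenceBound p a u x) (volume.restrict Ω) := by
    obtain ⟨R, hR⟩ := hΩ.isBounded.subset_closedBall 0
    exact ((integrableOn_fluxDivergenceBound hp ha hu R).mono_set hR).const_mul C₃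
  have m1 : ∀ k, AEStronglyMeasurable (fun x => fderiv ℝ ψ x (F k x)) (volume.restrict Ω) :=
    fun k => (hdc.clm_apply (hFc k).continuous).aestronglyMeasurable
  have id2 : ∀ k, Integrable (fun x => ψ x * inner ℝ (F k x) (exteriorUnitNormal Ω x))
      (surfaceMeasure Ω) ∧ ∫ y in Ω, divergence (fun x => ψ x • F k x) y =
        ∫ x, ψ x * inner ℝ (F k x) (exteriorUnitNormal Ω x) ∂(surfaceMeasure Ω) := fun k => by
    have := hΩ.divergence_theorem (G := fun x => ψ x • F k x) (hψ.smul (hFc k))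
    simpa only [real_inner_smul_left] using this
  have m3 : ∀ k, AEStronglyMeasurable (fun x => ψ x * divergence (F k) x) (volume.restrict Ω) :=
    fun k => (hψ.continuous.mul (continuous_divergence (hFc k))).aestronglyMeasurable
  have t1 : ∀ᵐ x ∂(volume.restrict Ω), Tendsto (fun k => fderiv ℝ ψ x (F k x)) atTop
      (𝓝 (fderiv ℝ ψ x (pFlux p a u x))) := Eventually.of_forall fun x =>
    ((fderiv ℝ ψ x).continuous.tendsto _).comp (hFt x)
  have t2 : ∀ᵐ x ∂(surfaceMeasure Ω),
      Tendsto (fun k => ψ x * inner ℝ (F k x) (exteriorUnitNormal Ω x)) atTop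
        (𝓝 (ψ x * inner ℝ (pFlux p a u x) (exteriorUnitNormal Ω x))) :=
    Eventually.of_forall fun x => ((hFt x).inner tendsto_const_nhds).const_mul _
  have t3 : ∀ᵐ x ∂(volume.restrict Ω), Tendsto (fun k => ψ x * divergence (F k) x) atTop
      (𝓝 (ψ x * divergence (pFlux p a u) x)) := by
    filter_upwards [hdiff, ae_restrict_of_ae (ae_tendsto_divergence_regularizedFlux ha hu)]
      with x hx ht
    exact ((ht hx).comp hs).const_mul _
  have l1 := tendsto_integral_of_dominated_convergence _ m1 (integrable_const C₁) b1 t1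
  have l2 := tendsto_integral_of_dominated_convergence _ (fun k => (id2 k).1.1)
    (integrable_const C₂) b2 t2
  have l3 := tendsto_integral_of_dominated_convergence _ m3 i3 b3 t3
  refine ⟨?_, ?_, ?_, ?_⟩
  · refine i3.mono' (aestronglyMeasurable_of_tendsto_ae atTop m3 t3) ?_
    filter_upwards [ae_all_iff.2 b3, t3] with x hb ht
    exact le_of_tendsto' ht.norm hb
  · refine (integrable_const C₁).mono' (aestronglyMeasurable_of_tendsto_ae atTop m1 t1) ?_
    filter_upwards [ae_all_iff.2 b1, t1] with x hb ht
    exact le_of_tendsto' ht.norm hb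
  · refine (integrable_const C₂).mono'
      (aestronglyMeasurable_of_tendsto_ae atTop (fun k => (id2 k).1.1) t2) ?_
    filter_upwards [ae_all_iff.2 b2, t2] with x hb ht
    exact le_of_tendsto' ht.norm hb
  · refine tendsto_nhds_unique ((l3.add l1).congr fun k => ?_) l2
    rw [← (id2 k).2, ← integral_add (i3.mono' (m3 k) (b3 k))
      ((integrable_const C₁).mono' (m1 k) (b1 k))]
    refine integral_congr_ae (Eventually.of_forall fun x => ?_)
    exact (divergence_smul (hψ.differentiable (by simp) x)
      ((hFc k).differentiable (by simp) x)).symm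

end WeakFormulation

/-! ### The test function and the final inequality. -/

section HardyInequality

variable {n : ℕ} {p : ℝ} {a u b β φ : EuclideanSpace ℝ (Fin n) → ℝ}
  {Ω : Set (EuclideanSpace ℝ (Fin n))}

/-- A globally `C¹` function which agrees with the power `s ^ q` for `s ≥ m`. -/
theorem exists_contDiff_eq_rpow {m : ℝ} (hm : 0 < m) (q : ℝ) :
    ∃ k : ℝ → ℝ, ContDiff ℝ 1 k ∧ ∀ s, m ≤ s → k s = s ^ q := by
  refine ⟨fun s => Real.smoothTransition ((s - m / 2) / (m / 2)) * s ^ q, ?_, fun s hs => ?_⟩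
  · refine contDiff_iff_contDiffAt.2 fun s => ?_
    rcases lt_or_ge s (m / 2) with hs | hs
    · refine (contDiffAt_const (c := (0 : ℝ))).congr_of_eventuallyEq ?_
      filter_upwards [gt_mem_nhds hs] with t ht
      rw [Real.smoothTransition.zero_of_nonpos, zero_mul]
      exact div_nonpos_of_nonpos_of_nonneg (by linarith) (by linarith)
    · refine ContDiffAt.mul ?_ (Real.contDiffAt_rpow_const_of_ne (by linarith))
      exact (Real.smoothTransition.contDiff.comp
        ((contDiff_id.sub contDiff_const).div_const _)).contDiffAt
  · have h1 : 1 ≤ (s - m / 2) / (m / 2) := by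
      rw [le_div_iff₀ (by linarith)]
      linarith
    simp only [Real.smoothTransition.one_of_one_le h1, one_mul]

theorem gradient_div {x : EuclideanSpace ℝ (Fin n)} (hφ : DifferentiableAt ℝ φ x)
    (hu : DifferentiableAt ℝ u x) (hux : 0 < u x) :
    gradient φ x = (φ x / u x) • gradient u x + u x • gradient (fun y => φ y / u y) x := by
  have hr : DifferentiableAt ℝ (fun y => φ y / u y) x := by
    simpa only [div_eq_mul_inv] using hφ.fun_mul (hu.fun_inv hux.ne')
  have h1 := hr.hasFDerivAt.mul hu.hasFDerivAt
  have h2 : (fun y => φ y / u y * u y) =ᶠ[𝓝 x] φ := by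
    filter_upwards [hu.continuousAt.eventually (lt_mem_nhds hux)] with y hy
    exact div_mul_cancel₀ _ hy.ne'
  have h3 := (h1.congr_of_eventuallyEq h2.symm).fderiv
  refine ext_inner_right ℝ fun v => ?_
  rw [inner_add_left, real_inner_smul_left, real_inner_smul_left, inner_gradient_eq_fderiv,
    inner_gradient_eq_fderiv, inner_gradient_eq_fderiv, h3]
  simp

theorem fderiv_abs_rpow_mul_rpow_apply (hp : 1 < p) {x : EuclideanSpace ℝ (Fin n)}
    (hφ : DifferentiableAt ℝ φ x) (hu : DifferentiableAt ℝ u x) (hux : 0 < u x)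
    (v : EuclideanSpace ℝ (Fin n)) :
    fderiv ℝ (fun y => |φ y| ^ p * u y ^ (1 - p)) x v =
      |φ x / u x| ^ p * inner ℝ (gradient u x) v + p * |φ x / u x| ^ (p - 2) * (φ x / u x) * u x *
        inner ℝ (gradient (fun y => φ y / u y) x) v := by
  have hr : DifferentiableAt ℝ (fun y => φ y / u y) x := by
    simpa only [div_eq_mul_inv] using hφ.fun_mul (hu.fun_inv hux.ne')
  have h1 := (hasDerivAt_abs_rpow (φ x / u x) hp).comp_hasFDerivAt x hr.hasFDerivAt
  have h2 := h1.mul hu.hasFDerivAt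
  -- Rewriting the test function as `|φ/u|^p u` makes its gradient come out in terms of `∇(φ/u)`.
  have h3 : (fun y => |φ y| ^ p * u y ^ (1 - p)) =ᶠ[𝓝 x] fun y => |φ y / u y| ^ p * u y := by
    filter_upwards [hu.continuousAt.eventually (lt_mem_nhds hux)] with y hy
    rw [abs_div, abs_of_pos hy, Real.div_rpow (abs_nonneg _) hy.le, Real.rpow_sub hy, Real.rpow_one]
    ring
  have h4 : fderiv ℝ (fun y => |φ y / u y| ^ p * u y) x = _ := h2.fderiv
  rw [h3.fderiv_eq, h4, inner_gradient_eq_fderiv, inner_gradient_eq_fderiv]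
  simp only [add_apply, smul_apply, smul_eq_mul, Function.comp_apply]
  ring

/-- The pointwise expression of the flux against the gradient of `|φ|^p u^(1-p)`. -/
theorem fderiv_apply_pFlux (hp : 1 < p) {x : EuclideanSpace ℝ (Fin n)}
    (hφ : DifferentiableAt ℝ φ x) (hu : DifferentiableAt ℝ u x) (hux : 0 < u x) :
    fderiv ℝ (fun y => |φ y| ^ p * u y ^ (1 - p)) x (pFlux p a u x) =
      a x * (‖(φ x / u x) • gradient u x‖ ^ p + p * ‖(φ x / u x) • gradient u x‖ ^ (p - 2) *
        inner ℝ ((φ x / u x) • gradient u x) (u x • gradient (fun y => φ y / u y) x)) := by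
  rw [fderiv_abs_rpow_mul_rpow_apply hp hφ hu hux, pFlux, norm_smul, Real.norm_eq_abs,
    Real.mul_rpow (abs_nonneg _) (norm_nonneg _), Real.mul_rpow (abs_nonneg _) (norm_nonneg _)]
  simp only [real_inner_smul_left, real_inner_smul_right, real_inner_self_eq_norm_sq,
    real_inner_comm (gradient u x)]
  have hN : ‖gradient u x‖ ^ (p - 2) * ‖gradient u x‖ ^ 2 = ‖gradient u x‖ ^ p := by
    rcases (norm_nonneg (gradient u x)).eq_or_lt with h | h
    · rw [← h, Real.zero_rpow (show p ≠ 0 by linarith)]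
      simp
    · rw [← Real.rpow_natCast, ← Real.rpow_add h]
      congr 1
      push_cast
      ring
  rw [← hN]
  ring

theorem remainderGe_add_le (hp : 2 ≤ p) {x : EuclideanSpace ℝ (Fin n)} (hax : 0 ≤ a x)
    (hφ : DifferentiableAt ℝ φ x) (hu : DifferentiableAt ℝ u x) (hux : 0 < u x) :
    fderiv ℝ (fun y => |φ y| ^ p * u y ^ (1 - p)) x (pFlux p a u x) +
      2 * (1 / 2) ^ p * remainderGe p a u φ x ≤ a x * ‖gradient φ x‖ ^ p := by
  have h := norm_rpow_add_inner_add_le_of_two_le hp ((φ x / u x) • gradient u x)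
    (u x • gradient (fun y => φ y / u y) x)
  rw [← gradient_div hφ hu hux, norm_smul (u x), Real.norm_of_nonneg hux.le,
    Real.mul_rpow hux.le (norm_nonneg _)] at h
  rw [fderiv_apply_pFlux (by linarith) hφ hu hux, remainderGe]
  refine le_trans (le_of_eq ?_) (mul_le_mul_of_nonneg_left h hax)
  ring

theorem remainderLt_add_le (hp : 1 < p) (hp2 : p < 2) {x : EuclideanSpace ℝ (Fin n)}
    (hax : 0 ≤ a x) (hφ : DifferentiableAt ℝ φ x) (hu : DifferentiableAt ℝ u x) (hux : 0 < u x) :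
    fderiv ℝ (fun y => |φ y| ^ p * u y ^ (1 - p)) x (pFlux p a u x) +
      p * (p - 1) / 2 * remainderLt p a u φ x ≤ a x * ‖gradient φ x‖ ^ p := by
  have h := norm_rpow_add_inner_add_le_of_lt_two hp hp2 ((φ x / u x) • gradient u x)
    (u x • gradient (fun y => φ y / u y) x)
  rw [← gradient_div hφ hu hux, norm_smul (u x), Real.norm_of_nonneg hux.le, mul_comm (u x) ‖_‖,
    mul_pow] at h
  rw [fderiv_apply_pFlux hp hφ hu hux, remainderLt]
  refine le_trans (le_of_eq ?_) (mul_le_mul_of_nonneg_left h hax)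
  ring

theorem measurable_remainderGe (ha : Measurable a) (hu : Measurable u) :
    Measurable (remainderGe p a u φ) :=
  (ha.mul ((measurable_gradient _).norm.pow_const _)).mul (hu.pow_const _)

theorem measurable_remainderLt (ha : Measurable a) (hu : Measurable u) (hφ : Measurable φ) :
    Measurable (remainderLt p a u φ) := by
  have h1 := (measurable_gradient (fun y => φ y / u y)).norm
  have h2 : Measurable fun x => ‖(φ x / u x) • gradient u x‖ :=
    ((hφ.div hu).smul (measurable_gradient u)).norm
  exact ha.mul (((h1.pow_const 2).mul (hu.pow_const 2)).div ((h2.add (h1.mul hu)).pow_const _))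

/-- The part common to both ranges of `p`: any nonnegative measurable remainder obeying the
pointwise bound on `Ω` passes to the integrated inequality, and its integrability follows from that
bound. -/
theorem hardyInequality_of_remainder_le (hp : 1 < p) (hΩ : IsSmoothBoundedDomain Ω)
    (ha : ContDiff ℝ 1 a) (hu : ContDiff ℝ ∞ u) (hu0 : ∀ x ∈ closure Ω, 0 < u x)
    (hb : LocallyIntegrableOn b Ω volume)
    (hineq : ∀ᵐ x ∂(volume.restrict Ω), DifferentiableAt ℝ (pFlux p a u) x ∧
      -divergence (pFlux p a u) x ≥ b x * u x ^ (p - 1))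
    (hbdry : ∀ᵐ x ∂(surfaceMeasure Ω),
      a x * ‖gradient u x‖ ^ (p - 2) * exteriorNormalDeriv Ω u x = β x * u x ^ (p - 1))
    (hφ : ContDiff ℝ ∞ φ) {c : ℝ} (hc : 0 < c) {R : EuclideanSpace ℝ (Fin n) → ℝ}
    (hRm : Measurable R) (hR0 : ∀ x ∈ Ω, 0 ≤ R x)
    (hR : ∀ x ∈ Ω, fderiv ℝ (fun y => |φ y| ^ p * u y ^ (1 - p)) x (pFlux p a u x) + c * R x ≤
      a x * ‖gradient φ x‖ ^ p) :
    HardyInequality Ω p a b β φ c R := by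
  have hK : IsCompact (closure Ω) :=
    Metric.isCompact_of_isClosed_isBounded isClosed_closure hΩ.isBounded.closure
  -- `u` has a positive minimum on the compact closure but may vanish elsewhere, so `u^(1-p)` is
  -- replaced by a globally `C¹` function of `u` that agrees with it on the closure.
  obtain ⟨x₀, hx₀, hmin⟩ := hK.exists_isMinOn hΩ.isConnected.nonempty.closure
    hu.continuous.continuousOn
  obtain ⟨k, hkc, hk⟩ := exists_contDiff_eq_rpow (hu0 x₀ hx₀) (1 - p)
  have hku : ∀ x ∈ closure Ω, k (u x) = u x ^ (1 - p) := fun x hx => hk _ (hmin hx)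
  have hφ1 : ContDiff ℝ 1 φ := hφ.of_le (by simp)
  have habs : ContDiff ℝ 1 fun x => |φ x| ^ p := hφ1.norm_rpow hp
  set ψ : EuclideanSpace ℝ (Fin n) → ℝ := fun x => |φ x| ^ p * k (u x) with hψ
  have hψc : ContDiff ℝ 1 ψ := habs.mul (hkc.comp (hu.of_le (by simp)))
  have hψe : ∀ x ∈ closure Ω, ψ x = |φ x| ^ p * u x ^ (1 - p) := fun x hx => by
    simp only [hψ, hku x hx]
  have hψu : ∀ x ∈ closure Ω, ψ x * u x ^ (p - 1) = |φ x| ^ p := fun x hx => by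
    rw [hψe x hx, mul_assoc, ← Real.rpow_add (hu0 x hx), show 1 - p + (p - 1) = 0 by ring,
      Real.rpow_zero, mul_one]
  have hψ0 : ∀ x ∈ closure Ω, 0 ≤ ψ x := fun x hx => by
    rw [hψe x hx]
    have := hu0 x hx
    positivity
  have hψd : ∀ x ∈ Ω, fderiv ℝ ψ x = fderiv ℝ (fun y => |φ y| ^ p * u y ^ (1 - p)) x :=
    fun x hx => Filter.EventuallyEq.fderiv_eq (by
      filter_upwards [hΩ.isOpen.mem_nhds hx] with y hy using hψe y (subset_closure hy))
  have hmem := ae_restrict_mem (μ := volume) hΩ.isOpen.measurableSet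
  obtain ⟨hI1, hI2, hI3, hid⟩ := integral_mul_divergence_pFlux hp hΩ ha hu hψc
    (hineq.mono fun x hx => hx.1)
  have hA : IntegrableOn (fun x => a x * ‖gradient φ x‖ ^ p) Ω := by
    have hcont : Continuous fun x => a x * ‖gradient φ x‖ ^ p :=
      ha.continuous.mul ((continuous_gradient hφ1).norm.rpow_const fun _ => Or.inr (by linarith))
    exact (hcont.continuousOn.integrableOn_compact hK).mono_set subset_closure
  have hcR : ∀ᵐ x ∂(volume.restrict Ω),
      c * R x ≤ a x * ‖gradient φ x‖ ^ p - fderiv ℝ ψ x (pFlux p a u x) := by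
    filter_upwards [hmem] with x hx
    rw [hψd x hx]
    linarith [hR x hx]
  have hRi : IntegrableOn R Ω := by
    refine ((hA.sub hI2).const_mul c⁻¹).mono' hRm.aestronglyMeasurable ?_
    filter_upwards [hmem, hcR] with x hx h
    rw [Real.norm_of_nonneg (hR0 x hx), ← div_eq_inv_mul, le_div_iff₀ hc, mul_comm]
    exact h
  -- The boundary condition multiplied by `ψ`, with `ψ u^(p-1) = |φ|^p`. This also makes the
  -- boundary term integrable, as the flux is.
  have hB : (fun x => ψ x * inner ℝ (pFlux p a u x) (exteriorUnitNormal Ω x))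
      =ᵐ[surfaceMeasure Ω] fun x => β x * |φ x| ^ p := by
    filter_upwards [hbdry, ae_restrict_mem isClosed_frontier.measurableSet] with x hx hxf
    rw [pFlux, real_inner_smul_left, inner_gradient_eq_fderiv,
      ← hψu x (frontier_subset_closure hxf), ← mul_assoc (β x), mul_right_comm (β x), ← hx]
    simp only [exteriorNormalDeriv]
    ring
  -- The differential inequality multiplied by `ψ ≥ 0`. The right side is integrable, so the
  -- positive part of `b|φ|^p` is too, with no global integrability of `b`.
  have hbψ : ∀ᵐ x ∂(volume.restrict Ω),
      b x * |φ x| ^ p ≤ -(ψ x * divergence (pFlux p a u) x) := by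
    filter_upwards [hmem, hineq] with x hx h
    have := mul_le_mul_of_nonneg_left h.2 (hψ0 x (subset_closure hx))
    rw [← hψu x (subset_closure hx)]
    linarith
  have hbm : AEStronglyMeasurable b (volume.restrict Ω) := hb.aestronglyMeasurable
  refine ⟨hA, hRi, hI3.congr hB, ?_, fun hbi => ?_⟩
  · refine hI1.norm.mono' ((hbm.aemeasurable.max aemeasurable_const).aestronglyMeasurable.mul
      habs.continuous.aestronglyMeasurable) ?_
    filter_upwards [hbψ] with x hx
    have h0 : 0 ≤ |φ x| ^ p := by positivity
    rw [Real.norm_of_nonneg (mul_nonneg (le_max_right _ _) h0), max_mul_of_nonneg _ _ h0, zero_mul]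
    exact max_le (hx.trans (neg_le_abs _)) (norm_nonneg _)
  · have e1 := integral_mono_ae hbi hI1.neg hbψ
    have e2 := integral_mono_ae (hRi.const_mul c) (hA.sub hI2) hcR
    simp only [Pi.neg_apply, Pi.sub_apply] at e1 e2
    rw [integral_neg] at e1
    rw [integral_const_mul, integral_sub hA hI2] at e2
    rw [← integral_congr_ae hB, ← hid]
    linarith

end HardyInequality

/-- The functions `a`, `u`, `φ` of class `C¹` or `C^∞` up to the boundary of `Ω` are given by
extensions of the same class to all of `ℝⁿ`; only their restrictions to the closure of `Ω` matter.
The differential inequality is required almost everywhere in `Ω`, in the classical sense. -/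
theorem theorem2p1 (p : ℝ) (hp : 1 < p) :
    ∃ c : ℝ, 0 < c ∧
      ∀ (n : ℕ), 1 ≤ n →
      ∀ Ω : Set (EuclideanSpace ℝ (Fin n)), IsSmoothBoundedDomain Ω →
      ∀ a u b β : EuclideanSpace ℝ (Fin n) → ℝ,
        ContDiff ℝ 1 a → (∀ x ∈ Ω, 0 ≤ a x) →
        ContDiff ℝ ∞ u → (∀ x ∈ closure Ω, 0 < u x) →
        LocallyIntegrableOn b Ω volume →
        LocallyIntegrableOn β (frontier Ω) (surfaceMeasure Ω) →
        (∀ᵐ x ∂(volume.restrict Ω), DifferentiableAt ℝ (pFlux p a u) x ∧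
          -divergence (pFlux p a u) x ≥ b x * u x ^ (p - 1)) →
        (∀ᵐ x ∂(surfaceMeasure Ω),
          a x * ‖gradient u x‖ ^ (p - 2) * exteriorNormalDeriv Ω u x = β x * u x ^ (p - 1)) →
        ∀ φ : EuclideanSpace ℝ (Fin n) → ℝ, ContDiff ℝ ∞ φ →
          (2 ≤ p → HardyInequality Ω p a b β φ c (remainderGe p a u φ)) ∧
          (p < 2 → HardyInequality Ω p a b β φ c (remainderLt p a u φ)) := by
  have hd : ∀ {n : ℕ} {f : EuclideanSpace ℝ (Fin n) → ℝ}, ContDiff ℝ ∞ f → Differentiable ℝ f :=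
    fun h => h.differentiable (by simp)
  -- The constant is that of the vector inequality: `2^(1-p)` for `p ≥ 2` and `p(p-1)/2` for `p <
  -- 2`.
  rcases le_or_gt 2 p with hp2 | hp2
  · have hc : (0 : ℝ) < 2 * (1 / 2) ^ p := by positivity
    refine ⟨2 * (1 / 2) ^ p, hc, fun n _ Ω hΩ a u b β ha ha0 hu hu0 hb _ hineq hbdry φ hφ =>
      ⟨fun _ => ?_, fun h => absurd h hp2.not_gt⟩⟩
    refine hardyInequality_of_remainder_le hp hΩ ha hu hu0 hb hineq hbdry hφ hc
      (measurable_remainderGe ha.continuous.measurable hu.continuous.measurable)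
      (fun x hx => ?_) (fun x hx => remainderGe_add_le hp2 (ha0 x hx) (hd hφ x) (hd hu x)
        (hu0 x (subset_closure hx)))
    have h1 := ha0 x hx
    have h2 := (hu0 x (subset_closure hx)).le
    unfold remainderGe
    positivity
  · have hc : 0 < p * (p - 1) / 2 := by
      have : 0 < p - 1 := by linarith
      positivity
    refine ⟨p * (p - 1) / 2, hc, fun n _ Ω hΩ a u b β ha ha0 hu hu0 hb _ hineq hbdry φ hφ =>
      ⟨fun h => absurd h hp2.not_ge, fun _ => ?_⟩⟩
    refine hardyInequality_of_remainder_le hp hΩ ha hu hu0 hb hineq hbdry hφ hc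
      (measurable_remainderLt ha.continuous.measurable hu.continuous.measurable
        hφ.continuous.measurable)
      (fun x hx => ?_) (fun x hx => remainderLt_add_le hp hp2 (ha0 x hx) (hd hφ x) (hd hu x)
        (hu0 x (subset_closure hx)))
    have h1 := ha0 x hx
    have h2 := (hu0 x (subset_closure hx)).le
    unfold remainderLt
    positivity
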